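/- **Setting.** Let $\Sigma_2=\{0,1\}^{\mathbb N}$ with metric $d[s,t]=\sum_{i\ge 0}|s_i-t_i|2^{-i}$ and shift $\sigma$. Let $\Lambda\subseteq[0,1]$, let $S:\Lambda\to\Sigma_2$ be a homeomorphism and $h:\Lambda\to\Lambda$ a map with $S\circ h=\sigma\circ S$. Let $\Pi$ be the set of all sequences $\zeta=\{\zeta_i\}_{i\in\mathbb Z}$, $\zeta_i=i+\kappa_i$, with $\kappa_i\in\Lambda$ and $\kappa_{i+1}=h(\kappa_i)$ for all $i\in\mathbb Z$; such a $\zeta$ is said to start at $t_0=\zeta_0=\kappa_0$. Assume that the members of these sequences are distinct, i.e. $t<1+h(t)$ for all $t\in\Lambda$. For $\zeta\in\Pi$ consider $$z'=Az+f(z),\ t\ne\zeta_i;\qquad \Delta z|_{t=\zeta_i}=Bz(\zeta_i)+W(z(\zeta_i)),\qquad(1)$$ where $z\in\mathbb R^n$ (Euclidean norm; operator norm for matrices), $\Delta z|_{t=\zeta_i}=z(\zeta_i+)-z(\zeta_i)$, and solutions are left continuous, differentiable off the $\zeta_i$, and satisfy the differential equation with the left derivative at $\zeta_i$. Let $Z_\zeta(t,s)$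 be the transition matrix of $z'=Az$, $\Delta z|_{t=\zeta_i}=Bz(\zeta_i)$. **Assumptions.** * (C1) $A,B$ are real $n\times n$ matrices, $\det(I+B)\ne0$. * (C2) $f,W:\mathbb R^n\to\mathbb R^n$ satisfy $\|f(x_1)-f(x_2)\|+\|W(x_1)-W(x_2)\|\le L\|x_1-x_2\|$ for all $x_1,x_2$, with $L>0$. * (C3) $Bx+W(x)\ne0$ for all $x\in\mathbb R^n$. * (C4) $M_0=\sup_x\|f(x)\|+\sup_x\|W(x)\|<\infty$. * (C5) $AB=BA$ and all eigenvalues of $A+\ln(I+B)$ have negative real part. * $N,\omega>0$ are constants with $\|Z_\zeta(t,s)\|\le Ne^{-\omega(t-s)}$ for all $\zeta\in\Pi$ and $t\ge s$. * (C6) $NL\left[\frac2\omega+\frac{e^\omega}{1-e^{-\omega}}\right]<1$. * (C7) $-\omega+NL+\ln(1+NL)<0$. * (C8) $L<\dfrac{\left[\frac{2\underline m}{3\overline m}-\frac1q\right]\underline m\,\eta}{2M_1(\overline m+\underline m)}$, where $\overline m=\max_{|u|\le1}\|e^{Au}\|$, $\underline m=\min_{|u|\le1}\|e^{Au}\|$,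 $M_1=NM_0\left[\frac1\omega+\frac{e^\omega}{1-e^{-\omega}}\right]$, $\eta=\min_{\|x\|\le M_1}\|Bx+W(x)\|$, and $q\ge3$ is a number with $\frac1q<\frac{2\underline m}{3\overline m}$. **Definition.** Let $\mathcal{PCB}$ be the set of all solutions of (1), $\zeta\in\Pi$, that are bounded on $\mathbb R$. For functions $\xi,\psi$ with discontinuity moments $\theta,\theta'$ and an interval $J\subset[\theta_0,\infty)\cap[\theta_0',\infty)$ write $\xi(\epsilon,J)\psi$ if $\sup\{|\theta_i-\theta_i'|:\theta_i,\theta'_i\in J\}<\epsilon$ and $\|\xi(t)-\psi(t)\|<\epsilon$ for all $t\in J$ outside the union of the closed intervals with end points $\theta_i,\theta_i'$, over all $i$ with $\theta_i,\theta_i'\in J$. **Theorem.** Under (C1)–(C8), $\mathcal{PCB}$ is a chaotic attractor, that is: 1. (Attractor) For each $\zeta\in\Pi$, (1) has exactly one solution $z_\zeta$ bounded on $\mathbb R$; the $z_\zeta$ are bounded uniformly in $\zeta\in\Pi$; and every solution $y$ of (1) on $[\zeta_0,\infty)$ satisfies $\|y(t)-z_\zeta(t)\|\to0$ as $t\to\infty$.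 2. (Sensitivity) There are $\epsilon_0,\epsilon_1>0$ such that for all $t_0\in\Lambda$ and $\delta>0$ there is $t_1\in\Lambda$ with $|t_0-t_1|<\delta$ such that for all $\zeta^0,\zeta^1\in\Pi$ starting at $t_0,t_1$ there is an interval $Q\subset[t_0,\infty)$ of length at least $\epsilon_1$ that contains no $\zeta^0_i$ and no $\zeta^1_i$ and on which $\|z_{\zeta^0}(t)-z_{\zeta^1}(t)\|\ge\epsilon_0$. 3. (Density of periodic solutions) For every $z\in\mathcal{PCB}$ and all $\epsilon,E>0$ there are $\phi\in\mathcal{PCB}$ with a period $p\in\mathbb N$, $p\ge 1$, and an open interval $J$ of length $E$ with $\phi(\epsilon,J)z$. 4. (Dense solution) There is $t^*\in\Lambda$ such that for every $\zeta^*\in\Pi$ starting at $t^*$ the solution $z_*=z_{\zeta^*}$ is dense in $\mathcal{PCB}$: for every $z_1\in\mathcal{PCB}$ and all $\epsilon,E>0$ there are an open interval $J$ of length $E$ and an integer $m$ with $z_*(\cdot+m)(\epsilon,J)z_1$, where the $i$-th discontinuity moment of $z_*(\cdot+m)$ is $\zeta^*_{i+m}-m$. -/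

import Mathlib

open Set Filter Topology
open scoped ENNReal Matrix.Norms.L2Operator

/-- `z` solves the impulsive equation `z' = F z` for `t ≠ θ i`, `Δz = G z` at `t = θ i`, on the
domain `D` (used with `D` the whole line or a half-line `[s, ∞)`): `z` is left continuous, is
differentiable off the moments `θ i`, has left derivatives at the moments, satisfies the differential
equation (with the left derivative at the moments), and
`z (θ i +) - z (θ i) = G (z (θ i))`. Left continuity is part of left differentiability. -/
structure IsImpulsiveSolution {V : Type*} [NormedAddCommGroup V] [NormedSpace ℝ V]
    (F G : V → V) (θ : ℤ → ℝ) (D : Set ℝ) (z : ℝ → V) : Prop where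
  ode : ∀ t ∈ D, t ∉ range θ → HasDerivWithinAt z (F (z t)) D t
  ode_left : ∀ i, θ i ∈ D → HasDerivWithinAt z (F (z (θ i))) (D ∩ Iic (θ i)) (θ i)
  jump : ∀ i, θ i ∈ D → Tendsto z (𝓝[>] (θ i)) (𝓝 (z (θ i) + G (z (θ i))))

/-- `Φ = Z(·, s)` on `[s, ∞)`: the transition matrix of `z' = A z`, `Δz = B z` at `θ i`. -/
def IsTransitionMatrix {n : ℕ} (A B : Matrix (Fin n) (Fin n) ℝ) (θ : ℤ → ℝ) (s : ℝ)
    (Φ : ℝ → Matrix (Fin n) (Fin n) ℝ) : Prop :=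
  IsImpulsiveSolution (fun X => A * X) (fun X => B * X) θ (Ici s) Φ ∧ Φ s = 1

/-- `C` is a (complex, primary) logarithm of the matrix `M`: `exp C = M` and `C` is a polynomial
in `M`. -/
def IsMatrixLog {n : ℕ} (C M : Matrix (Fin n) (Fin n) ℂ) : Prop :=
  NormedSpace.exp C = M ∧ C ∈ Algebra.adjoin ℂ {M}

/-- `A` and `B` commute, and all eigenvalues of `A + ln (I + B)` have negative real part.
(Since `A` commutes with every polynomial in `I + B`, the real parts of the eigenvalues do not depend
on the branch of the logarithm.) -/
def SpectralCondition {n : ℕ} (A B : Matrix (Fin n) (Fin n) ℝ) : Prop :=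
  Commute A B ∧ ∃ C : Matrix (Fin n) (Fin n) ℂ,
    IsMatrixLog C ((1 + B).map Complex.ofReal) ∧
      ∀ μ ∈ spectrum ℂ (A.map Complex.ofReal + C), μ.re < 0

/-- `κ` is a two-sided orbit of `h`: `κ (i + 1) = h (κ i)` for every integer `i`. Its values at
negative indices are arbitrary successive choices of preimages under `h`. -/
def IsOrbit {Λ : Set ℝ} (h : Λ → Λ) (κ : ℤ → Λ) : Prop :=
  ∀ i, κ (i + 1) = h (κ i)

/-- The impulse moments `ζ i = i + κ i`. -/
def moments {Λ : Set ℝ} (κ : ℤ → Λ) (i : ℤ) : ℝ := i + (κ i : ℝ)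

/-- Solutions, on `D`, of `z' = A z + f z`, `Δz = B z + W z` at `t = ζ i = i + κ i`. -/
def IsSolutionOn {n : ℕ} (A B : Matrix (Fin n) (Fin n) ℝ)
    (f W : EuclideanSpace ℝ (Fin n) → EuclideanSpace ℝ (Fin n)) {Λ : Set ℝ} (κ : ℤ → Λ)
    (D : Set ℝ) (z : ℝ → EuclideanSpace ℝ (Fin n)) : Prop :=
  IsImpulsiveSolution (fun x => Matrix.toEuclideanCLM (𝕜 := ℝ) A x + f x)
    (fun x => Matrix.toEuclideanCLM (𝕜 := ℝ) B x + W x) (moments κ) D z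

/-- Solutions on the whole line that are bounded on the whole line. The set `PCB` consists of these,
for all two-sided orbits `κ` of `h`. -/
def IsBoundedSolution {n : ℕ} (A B : Matrix (Fin n) (Fin n) ℝ)
    (f W : EuclideanSpace ℝ (Fin n) → EuclideanSpace ℝ (Fin n)) {Λ : Set ℝ} (κ : ℤ → Λ)
    (z : ℝ → EuclideanSpace ℝ (Fin n)) : Prop :=
  IsSolutionOn A B f W κ univ z ∧ ∃ K : ℝ, ∀ t, ‖z t‖ ≤ K

/-- The bounded set `PCB` is an attractor: each sequence of impulse moments has exactly one solution
bounded on `ℝ`, these solutions are uniformly bounded, and each of them attracts all solutions of the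
initial value problem on `[ζ 0, ∞)` with the same impulse moments. -/
def IsAttractor {n : ℕ} (A B : Matrix (Fin n) (Fin n) ℝ)
    (f W : EuclideanSpace ℝ (Fin n) → EuclideanSpace ℝ (Fin n)) {Λ : Set ℝ} (h : Λ → Λ) : Prop :=
  (∀ κ : ℤ → Λ, IsOrbit h κ → ∃! z, IsBoundedSolution A B f W κ z) ∧
  (∃ K : ℝ, ∀ κ : ℤ → Λ, IsOrbit h κ → ∀ z, IsBoundedSolution A B f W κ z → ∀ t, ‖z t‖ ≤ K) ∧
  (∀ κ : ℤ → Λ, IsOrbit h κ → ∀ z, IsBoundedSolution A B f W κ z →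
    ∀ y, IsSolutionOn A B f W κ (Ici (moments κ 0)) y →
      Tendsto (fun t => ‖y t - z t‖) atTop (𝓝 0))

/-- Sensitivity on `PCB`; the estimate holds for every choice of the two-sided orbits through
`t₀` and `t₁`. -/
def IsSensitive {n : ℕ} (A B : Matrix (Fin n) (Fin n) ℝ)
    (f W : EuclideanSpace ℝ (Fin n) → EuclideanSpace ℝ (Fin n)) {Λ : Set ℝ} (h : Λ → Λ) : Prop :=
  ∃ ε₀ > (0 : ℝ), ∃ ε₁ > (0 : ℝ), ∀ t₀ : Λ, ∀ δ > (0 : ℝ), ∃ t₁ : Λ, |(t₀ : ℝ) - t₁| < δ ∧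
    ∀ κ₀ κ₁ : ℤ → Λ, IsOrbit h κ₀ → IsOrbit h κ₁ → κ₀ 0 = t₀ → κ₁ 0 = t₁ →
    ∀ z₀ z₁, IsBoundedSolution A B f W κ₀ z₀ → IsBoundedSolution A B f W κ₁ z₁ →
      ∃ a b : ℝ, (t₀ : ℝ) ≤ a ∧ ε₁ ≤ b - a ∧
        (∀ t ∈ Icc a b, ε₀ ≤ ‖z₀ t - z₁ t‖) ∧
        (∀ i, moments κ₀ i ∉ Icc a b ∧ moments κ₁ i ∉ Icc a b)

/-- The distance `sup |θ i - θ' i|` over all `i` such that `θ i` and `θ' i` both lie in `J`. -/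
noncomputable def momentDist (J : Set ℝ) (θ θ' : ℤ → ℝ) : ℝ≥0∞ :=
  ⨆ (i : ℤ) (_ : θ i ∈ J ∧ θ' i ∈ J), edist (θ i) (θ' i)

/-- `ε`-equivalence on `J` of the piecewise continuous functions `ξ` and `ψ` with discontinuity
moments `θ` and `θ'`, where `J ⊆ [θ 0, ∞) ∩ [θ' 0, ∞)`. -/
def EpsEquivalent {V : Type*} [NormedAddCommGroup V] (ε : ℝ) (J : Set ℝ)
    (θ : ℤ → ℝ) (ξ : ℝ → V) (θ' : ℤ → ℝ) (ψ : ℝ → V) : Prop :=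
  J ⊆ Ici (θ 0) ∩ Ici (θ' 0) ∧
  momentDist J θ θ' < ENNReal.ofReal ε ∧
  ∀ t ∈ J, (t ∉ ⋃ i ∈ {i : ℤ | θ i ∈ J ∧ θ' i ∈ J}, uIcc (θ i) (θ' i)) → ‖ξ t - ψ t‖ < ε

/-- The periodic solutions are dense in `PCB`. -/
def PeriodicSolutionsDense {n : ℕ} (A B : Matrix (Fin n) (Fin n) ℝ)
    (f W : EuclideanSpace ℝ (Fin n) → EuclideanSpace ℝ (Fin n)) {Λ : Set ℝ} (h : Λ → Λ) : Prop :=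
  ∀ κ₁ : ℤ → Λ, IsOrbit h κ₁ → ∀ z, IsBoundedSolution A B f W κ₁ z →
    ∀ ε > (0 : ℝ), ∀ E > (0 : ℝ),
      ∃ (κ : ℤ → Λ) (φ : ℝ → EuclideanSpace ℝ (Fin n)), IsOrbit h κ ∧
        IsBoundedSolution A B f W κ φ ∧ (∃ p : ℕ, 0 < p ∧ Function.Periodic φ p) ∧
        ∃ a : ℝ, EpsEquivalent ε (Ioo a (a + E)) (moments κ) φ (moments κ₁) z

/-- The solution `z` in `PCB` with impulse moments `ζ i = i + κ i` is dense in the set of all orbits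
of `PCB`. The moments of the translate `z (· + m)` are `ζ (i + m) - m`. -/
def IsDenseSolution {n : ℕ} (A B : Matrix (Fin n) (Fin n) ℝ)
    (f W : EuclideanSpace ℝ (Fin n) → EuclideanSpace ℝ (Fin n)) {Λ : Set ℝ} (h : Λ → Λ)
    (κ : ℤ → Λ) (z : ℝ → EuclideanSpace ℝ (Fin n)) : Prop :=
  ∀ κ₁ : ℤ → Λ, IsOrbit h κ₁ → ∀ z₁, IsBoundedSolution A B f W κ₁ z₁ →
    ∀ ε > (0 : ℝ), ∀ E > (0 : ℝ), ∃ (a : ℝ) (m : ℤ),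
      EpsEquivalent ε (Ioo a (a + E)) (fun i => moments κ (i + m) - m) (fun t => z (t + m))
        (moments κ₁) z₁

/-- `PCB` is a chaotic attractor. -/
structure IsChaoticAttractor {n : ℕ} (A B : Matrix (Fin n) (Fin n) ℝ)
    (f W : EuclideanSpace ℝ (Fin n) → EuclideanSpace ℝ (Fin n)) {Λ : Set ℝ} (h : Λ → Λ) :
    Prop where
  attractor : IsAttractor A B f W h
  sensitive : IsSensitive A B f W h
  periodic_dense : PeriodicSolutionsDense A B f W h
  dense_solution : ∃ t : Λ, ∀ κ : ℤ → Λ, IsOrbit h κ → κ 0 = t →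
    ∀ z, IsBoundedSolution A B f W κ z → IsDenseSolution A B f W h κ z

/-- `M₀ = sup ‖f‖ + sup ‖W‖`. -/
noncomputable def supBound {n : ℕ}
    (f W : EuclideanSpace ℝ (Fin n) → EuclideanSpace ℝ (Fin n)) : ℝ :=
  (⨆ x, ‖f x‖) + ⨆ x, ‖W x‖

/-- `M₁ = N M₀ (1 / ω + e ^ ω / (1 - e ^ (-ω)))`. -/
noncomputable def solBound {n : ℕ}
    (f W : EuclideanSpace ℝ (Fin n) → EuclideanSpace ℝ (Fin n)) (N ω : ℝ) : ℝ :=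
  N * supBound f W * (1 / ω + Real.exp ω / (1 - Real.exp (-ω)))

/-- The maximum of `‖exp (u A)‖` over `|u| ≤ 1` (operator norm). -/
noncomputable def expMax {n : ℕ} (A : Matrix (Fin n) (Fin n) ℝ) : ℝ :=
  sSup ((fun u : ℝ => ‖NormedSpace.exp (u • A)‖) '' Icc (-1) 1)

/-- The minimum of `‖exp (u A)‖` over `|u| ≤ 1` (operator norm). -/
noncomputable def expMin {n : ℕ} (A : Matrix (Fin n) (Fin n) ℝ) : ℝ :=
  sInf ((fun u : ℝ => ‖NormedSpace.exp (u • A)‖) '' Icc (-1) 1)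

/-- The minimum of `‖B x + W x‖` over `‖x‖ ≤ r`. -/
noncomputable def jumpMin {n : ℕ} (B : Matrix (Fin n) (Fin n) ℝ)
    (W : EuclideanSpace ℝ (Fin n) → EuclideanSpace ℝ (Fin n)) (r : ℝ) : ℝ :=
  sInf ((fun x => ‖Matrix.toEuclideanCLM (𝕜 := ℝ) B x + W x‖) '' Metric.closedBall 0 r)

/-! The dynamics is a contraction driven by the moments, so every chaotic feature of the moments
passes to the bounded solutions.

Since `A` and `B` commute, the transition operator is explicit, `fundamentalMatrix`, and the assumed
decay applies to it. Variation of constants is used as an inequality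
(`IsForcedSolution.norm_sub_le`): apart from the forcing, `Z(τ, t) y(t)` is constant in `t`, so a
scalar function that grows faster than the forcing majorises it. A geometric majorant gives a common
bound for all bounded solutions; a Gronwall majorant, with at most one extra factor `1 + N L` per
moment and about one moment per unit of time, makes two solutions with the same moments approach
each other at the rate of (C7), which is `exists_rate`. The bounded solution is then the pullback
limit of solutions started from `0` in the remote past, and it attracts everything.

A bounded solution also forgets its past: its state at the `i`-th moment is exponentially close to
the state reached from `0` at the `0`-th moment, which depends continuously on `κ 0` alone. Hence,
if `κ 0` is close to `κ₁ 0`, the bounded solutions are `ε`-equivalent on a later interval, whatever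
the negative halves of the orbits (`exists_eventually_epsEquivalent`). Symbolic dynamics does the
rest: repeating a long word gives periodic solutions, and a sequence containing all words gives a
dense one.

For sensitivity, nearby points have orbits that separate at some time by a fixed amount
(`exists_separation`). Between the two corresponding moments one solution has jumped and the other
has not. By (C3) and compactness the jump is bounded below, and velocities are bounded, so just
before or just after the later jump the solutions are apart (`exists_interval_apart`). -/

/-- A sequence of impulse moments with exactly one moment attached to each unit interval. -/
structure IsMomentSeq (θ : ℤ → ℝ) : Prop where
  strictMono : StrictMono θ
  le_moment : ∀ i : ℤ, (i : ℝ) ≤ θ i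
  moment_le : ∀ i : ℤ, θ i ≤ i + 1

/-- The index `i` with `θ (i - 1) < t ≤ θ i`. -/
noncomputable def momentIndex (θ : ℤ → ℝ) (t : ℝ) : ℤ := sInf {i : ℤ | t ≤ θ i}

/-! ### Indexing of times by impulse moments -/

namespace IsMomentSeq

variable {θ : ℤ → ℝ}

lemma le_moment_index (hθ : IsMomentSeq θ) (t : ℝ) : t ≤ θ (momentIndex θ t) := by
  -- On `ℤ` the infimum is a minimum only for nonempty sets that are bounded below: `⌈t⌉` is a
  -- member and `⌊t⌋ - 1` a lower bound.
  refine Int.csInf_mem (s := {i : ℤ | t ≤ θ i}) ⟨⌈t⌉, (Int.le_ceil t).trans (hθ.le_moment _)⟩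
    ⟨⌊t⌋ - 1, fun i (hi : t ≤ θ i) => ?_⟩
  have h1 := hθ.moment_le i
  have h2 := Int.floor_le t
  have : ((⌊t⌋ : ℤ) : ℝ) ≤ ((i + 1 : ℤ) : ℝ) := by push_cast; linarith
  have := Int.cast_le.1 this
  omega

lemma index_le (hθ : IsMomentSeq θ) {t : ℝ} {i : ℤ} (h : t ≤ θ i) : momentIndex θ t ≤ i := by
  refine csInf_le ⟨⌊t⌋ - 1, fun i (hi : t ≤ θ i) => ?_⟩ h
  have h1 := hθ.moment_le i
  have h2 := Int.floor_le t
  have : ((⌊t⌋ : ℤ) : ℝ) ≤ ((i + 1 : ℤ) : ℝ) := by push_cast; linarith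
  have := Int.cast_le.1 this
  omega

lemma moment_index_sub_one_lt (hθ : IsMomentSeq θ) (t : ℝ) : θ (momentIndex θ t - 1) < t := by
  by_contra! h
  have := hθ.index_le h
  omega

lemma lt_index (hθ : IsMomentSeq θ) {t : ℝ} {i : ℤ} (h : θ i < t) : i < momentIndex θ t :=
  hθ.strictMono.lt_iff_lt.1 (h.trans_le (hθ.le_moment_index t))

lemma index_eq (hθ : IsMomentSeq θ) {t : ℝ} {i : ℤ} (h : θ (i - 1) < t) (h' : t ≤ θ i) :
    momentIndex θ t = i := by
  have h1 := hθ.index_le h'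
  have h2 := hθ.lt_index h
  omega

lemma index_moment (hθ : IsMomentSeq θ) (i : ℤ) : momentIndex θ (θ i) = i :=
  hθ.index_eq (hθ.strictMono (by omega)) le_rfl

lemma index_mono (hθ : IsMomentSeq θ) : Monotone (momentIndex θ) := fun _ t hst =>
  hθ.index_le (hst.trans (hθ.le_moment_index t))

/-- One moment per unit interval pins the index to the time up to `1`; this and the next bound turn
counts of impulses into lengths of time. -/
lemma index_lt_add_one (hθ : IsMomentSeq θ) (t : ℝ) : (momentIndex θ t : ℝ) < t + 1 := by
  have h1 := hθ.moment_index_sub_one_lt t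
  have h2 := hθ.le_moment (momentIndex θ t - 1)
  push_cast at h2
  linarith

lemma sub_one_le_index (hθ : IsMomentSeq θ) (t : ℝ) : t - 1 ≤ momentIndex θ t := by
  have h1 := hθ.le_moment_index t
  have h2 := hθ.moment_le (momentIndex θ t)
  linarith

lemma eventually_index_right (hθ : IsMomentSeq θ) (i : ℤ) :
    ∀ᶠ t in 𝓝[>] (θ i), momentIndex θ t = i + 1 := by
  filter_upwards [Ioo_mem_nhdsGT (hθ.strictMono (lt_add_one i))] with t ht
  exact hθ.index_eq (by simpa using ht.1) ht.2.le

lemma eventually_index_left (hθ : IsMomentSeq θ) (i : ℤ) :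
    ∀ᶠ t in 𝓝[≤] (θ i), momentIndex θ t = i := by
  filter_upwards [Ioc_mem_nhdsLE (hθ.strictMono (sub_one_lt i))] with t ht
  exact hθ.index_eq ht.1 ht.2

lemma lt_moment_index (hθ : IsMomentSeq θ) {t : ℝ} (ht : t ∉ range θ) :
    t < θ (momentIndex θ t) :=
  (hθ.le_moment_index t).lt_of_ne fun h => ht ⟨_, h.symm⟩

lemma eventually_index_eq (hθ : IsMomentSeq θ) {t : ℝ} (ht : t ∉ range θ) :
    ∀ᶠ r in 𝓝 t, momentIndex θ r = momentIndex θ t := by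
  filter_upwards [Ioo_mem_nhds (hθ.moment_index_sub_one_lt t) (hθ.lt_moment_index ht)] with r hr
  exact hθ.index_eq hr.1 hr.2.le

lemma notMem_range_of_mem_Ioo (hθ : IsMomentSeq θ) {t : ℝ} {i : ℤ} (h : θ (i - 1) < t)
    (h' : t < θ i) : t ∉ range θ := by
  rintro ⟨j, rfl⟩
  have h1 := hθ.strictMono.lt_iff_lt.1 h
  have h2 := hθ.strictMono.lt_iff_lt.1 h'
  omega

end IsMomentSeq

/-! ### Piecewise differentiable functions and mean value inequalities -/

section PiecewiseDifferentiable

variable {X : Type*} [NormedAddCommGroup X] [NormedSpace ℝ X] {u u' : ℝ → X}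

lemma continuousOn_Icc_of_hasDerivAt_Ioo {a b s : ℝ} (hu : ∀ t ∈ Ioo a b, HasDerivAt u (u' t) t)
    (hub : ContinuousWithinAt u (Iio b) b) (hs : s ∈ Ioo a b) : ContinuousOn u (Icc s b) := by
  intro t ht
  rcases ht.2.lt_or_eq with h1 | rfl
  · exact (hu t ⟨hs.1.trans_le ht.1, h1⟩).continuousAt.continuousWithinAt
  · exact (continuousWithinAt_Iio_iff_Iic.1 hub).mono Icc_subset_Iic_self

variable {R : Set ℝ} {s τ t : ℝ}

lemma tendsto_left_end_of_Icc_diff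
    (hu : ∀ t ∈ Icc s τ, t ∉ R → HasDerivWithinAt u (u' t) (Icc s τ) t)
    (hlt : s < τ) (hs : s ∉ R) : Tendsto u (𝓝[>] s) (𝓝 (u s)) := by
  have h1 : Icc s τ ∈ 𝓝[≥] s := Icc_mem_nhdsGE hlt
  exact (((hu s (left_mem_Icc.2 hlt.le) hs).continuousWithinAt).mono_of_mem_nhdsWithin h1).mono
    Ioi_subset_Ici_self

lemma hasDerivAt_of_Icc_diff
    (hu : ∀ t ∈ Icc s τ, t ∉ R → HasDerivWithinAt u (u' t) (Icc s τ) t)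
    (t : ℝ) (ht : t ∈ Ioo s τ) (h : t ∉ R) : HasDerivAt u (u' t) t :=
  (hu t (Ioo_subset_Icc_self ht) h).hasDerivAt (Icc_mem_nhds ht.1 ht.2)

lemma continuousWithinAt_Iio_of_Icc_diff {θ : ℤ → ℝ}
    (hu : ∀ t ∈ Icc s τ, t ∉ range θ → HasDerivWithinAt u (u' t) (Icc s τ) t)
    (hul : ∀ i, θ i ∈ Icc s τ → ContinuousWithinAt u (Icc s τ ∩ Iic (θ i)) (θ i))
    (ht : t ∈ Ioc s τ) : ContinuousWithinAt u (Iio t) t := by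
  have h1 : Icc s t ∈ 𝓝[≤] t := Icc_mem_nhdsLE ht.1
  refine continuousWithinAt_Iio_iff_Iic.2 ?_
  by_cases h : t ∈ range θ
  · obtain ⟨i, rfl⟩ := h
    exact (hul i (Ioc_subset_Icc_self ht)).mono_of_mem_nhdsWithin
      (mem_of_superset h1 fun r hr => ⟨⟨hr.1, hr.2.trans ht.2⟩, hr.2⟩)
  · exact (hu t (Ioc_subset_Icc_self ht) h).continuousWithinAt.mono_of_mem_nhdsWithin
      (mem_of_superset h1 fun r hr => ⟨hr.1, hr.2.trans ht.2⟩)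

end PiecewiseDifferentiable

/-- Mean value inequality on an interval, with one-sided limits at its left end. -/
lemma norm_sub_le_sub_of_norm_deriv_le {V : Type*} [NormedAddCommGroup V] [NormedSpace ℝ V]
    {w w' : ℝ → V} {v v' : ℝ → ℝ} {a b : ℝ} {p : V} {q : ℝ} (hab : a < b)
    (hw : ∀ t ∈ Ioo a b, HasDerivAt w (w' t) t) (hv : ∀ t ∈ Ioo a b, HasDerivAt v (v' t) t)
    (hwb : ContinuousWithinAt w (Iio b) b) (hvb : ContinuousWithinAt v (Iio b) b)
    (hwa : Tendsto w (𝓝[>] a) (𝓝 p)) (hva : Tendsto v (𝓝[>] a) (𝓝 q))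
    (h : ∀ t ∈ Ioo a b, ‖w' t‖ ≤ v' t) : ‖w b - p‖ ≤ v b - q := by
  have key : ∀ s ∈ Ioo a b, ‖w b - w s‖ ≤ v b - v s := by
    intro s hs
    have hmem : ∀ t ∈ Ico s b, t ∈ Ioo a b := fun t ht => ⟨hs.1.trans_le ht.1, ht.2⟩
    exact image_norm_le_of_norm_deriv_right_le_deriv_boundary' (f := fun t => w t - w s)
      (B := fun t => v t - v s) ((continuousOn_Icc_of_hasDerivAt_Ioo hw hwb hs).sub continuousOn_const)
      (fun t ht => ((hw t (hmem t ht)).sub_const _).hasDerivWithinAt) (by simp)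
      ((continuousOn_Icc_of_hasDerivAt_Ioo hv hvb hs).sub continuousOn_const)
      (fun t ht => ((hv t (hmem t ht)).sub_const _).hasDerivWithinAt)
      (fun t ht => h t (hmem t ht)) (right_mem_Icc.2 hs.2.le)
  refine le_of_tendsto_of_tendsto ((tendsto_const_nhds.sub hwa).norm) (tendsto_const_nhds.sub hva) ?_
  filter_upwards [Ioo_mem_nhdsGT hab] with s hs using key s hs

/-- Mean value inequality for functions with impulses at the moments `θ i`. -/
lemma norm_sub_le_sub_of_impulsive {V : Type*} [NormedAddCommGroup V] [NormedSpace ℝ V]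
    {θ : ℤ → ℝ} (hθ : IsMomentSeq θ) {w w' : ℝ → V} {v v' : ℝ → ℝ} {p : ℤ → V} {q : ℤ → ℝ}
    {s τ : ℝ} (hst : s ≤ τ)
    (hw : ∀ t ∈ Icc s τ, t ∉ range θ → HasDerivWithinAt w (w' t) (Icc s τ) t)
    (hwl : ∀ i, θ i ∈ Icc s τ → ContinuousWithinAt w (Icc s τ ∩ Iic (θ i)) (θ i))
    (hwj : ∀ i, θ i ∈ Ico s τ → Tendsto w (𝓝[>] (θ i)) (𝓝 (w (θ i) + p i)))
    (hv : ∀ t ∈ Icc s τ, t ∉ range θ → HasDerivWithinAt v (v' t) (Icc s τ) t)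
    (hvl : ∀ i, θ i ∈ Icc s τ → ContinuousWithinAt v (Icc s τ ∩ Iic (θ i)) (θ i))
    (hvj : ∀ i, θ i ∈ Ico s τ → Tendsto v (𝓝[>] (θ i)) (𝓝 (v (θ i) + q i)))
    (hd : ∀ t ∈ Icc s τ, t ∉ range θ → ‖w' t‖ ≤ v' t)
    (hj : ∀ i, θ i ∈ Ico s τ → ‖p i‖ ≤ q i) :
    ‖w τ - w s‖ ≤ v τ - v s := by
  -- The difference of the indices counts the moments in `[s, t)`; the induction is on this number.
  have main : ∀ k : ℕ, ∀ t ∈ Icc s τ, momentIndex θ t = momentIndex θ s + k →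
      ‖w t - w s‖ ≤ v t - v s := by
    intro k
    induction k with
    | zero =>
      intro t ht hk
      rcases ht.1.eq_or_lt with rfl | hlt
      · simp
      have hs : s ∉ range θ := by
        rintro ⟨i, rfl⟩
        have := hθ.lt_index hlt
        rw [hθ.index_moment] at hk
        simp at hk
        omega
      have hno : ∀ r ∈ Ioo s t, r ∉ range θ := fun r hr => by
        refine hθ.notMem_range_of_mem_Ioo (i := momentIndex θ s)
          ((hθ.moment_index_sub_one_lt s).trans hr.1) (hr.2.trans_le ?_)
        have := hθ.le_moment_index t
        rwa [hk, Nat.cast_zero, add_zero] at this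
      have hsub : ∀ r ∈ Ioo s t, r ∈ Ioo s τ := fun r hr => ⟨hr.1, hr.2.trans_le ht.2⟩
      have hsτ := hlt.trans_le ht.2
      exact norm_sub_le_sub_of_norm_deriv_le hlt (fun r hr => hasDerivAt_of_Icc_diff hw r (hsub r hr) (hno r hr))
        (fun r hr => hasDerivAt_of_Icc_diff hv r (hsub r hr) (hno r hr)) (continuousWithinAt_Iio_of_Icc_diff hw hwl ⟨hlt, ht.2⟩)
        (continuousWithinAt_Iio_of_Icc_diff hv hvl ⟨hlt, ht.2⟩) (tendsto_left_end_of_Icc_diff hw hsτ hs) (tendsto_left_end_of_Icc_diff hv hsτ hs)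
        (fun r hr => hd r (Ioo_subset_Icc_self (hsub r hr)) (hno r hr))
    | succ k ih =>
      intro t ht hk
      -- `θ i` is the last moment before `t`: the induction hypothesis covers `[s, θ i]`, the jump
      -- costs `q i`, and the smooth inequality runs from the right limit at `θ i`.
      set i := momentIndex θ t - 1 with hi
      have hit : θ i < t := hθ.moment_index_sub_one_lt t
      have hsi : s ≤ θ i :=
        (hθ.le_moment_index s).trans (hθ.strictMono.monotone (by push_cast at hk; omega))
      have h1 := ih (θ i) ⟨hsi, hit.le.trans ht.2⟩
        (by rw [hθ.index_moment]; push_cast at hk; omega)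
      have hno : ∀ r ∈ Ioo (θ i) t, r ∉ range θ := fun r hr =>
        hθ.notMem_range_of_mem_Ioo (i := momentIndex θ t) hr.1
          (hr.2.trans_le (hθ.le_moment_index t))
      have hsub : ∀ r ∈ Ioo (θ i) t, r ∈ Ioo s τ :=
        fun r hr => ⟨hsi.trans_lt hr.1, hr.2.trans_le ht.2⟩
      have hiI : θ i ∈ Ico s τ := ⟨hsi, hit.trans_le ht.2⟩
      have h2 := norm_sub_le_sub_of_norm_deriv_le hit
        (fun r hr => hasDerivAt_of_Icc_diff hw r (hsub r hr) (hno r hr))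
        (fun r hr => hasDerivAt_of_Icc_diff hv r (hsub r hr) (hno r hr)) (continuousWithinAt_Iio_of_Icc_diff hw hwl ⟨hsi.trans_lt hit, ht.2⟩)
        (continuousWithinAt_Iio_of_Icc_diff hv hvl ⟨hsi.trans_lt hit, ht.2⟩) (hwj i hiI) (hvj i hiI)
        (fun r hr => hd r (Ioo_subset_Icc_self (hsub r hr)) (hno r hr))
      have h3 := hj i hiI
      calc ‖w t - w s‖ = ‖(w t - (w (θ i) + p i)) + (w (θ i) - w s) + p i‖ := by congr 1; abel
        _ ≤ ‖w t - (w (θ i) + p i)‖ + ‖w (θ i) - w s‖ + ‖p i‖ := norm_add₃_le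
        _ ≤ v t - v s := by linarith
  have hm := hθ.index_mono hst
  exact main (momentIndex θ τ - momentIndex θ s).toNat τ (right_mem_Icc.2 hst) (by omega)

/-! ### The explicit transition operator -/

section FundamentalMatrix

variable {𝔸 : Type*} [NormedRing 𝔸] [NormedAlgebra ℝ 𝔸]

/-- The transition operator from time `s` to time `t ≥ s` of `z' = a z`, `Δz = b z` at `θ i`, for
commuting `a` and `b`. -/
noncomputable def fundamentalMatrix (θ : ℤ → ℝ) (a b : 𝔸) (t s : ℝ) : 𝔸 :=
  NormedSpace.exp ((t - s) • a) * (1 + b) ^ (momentIndex θ t - momentIndex θ s).toNat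

variable {θ : ℤ → ℝ} {a b : 𝔸}

@[simp]
lemma fundamentalMatrix_self (s : ℝ) : fundamentalMatrix θ a b s s = 1 := by
  simp [fundamentalMatrix]

/-- Between moments the power of `1 + b` is constant and only the exponential varies. At a moment
one more factor appears, and commutation moves it to the left of the exponential. This makes the
decay assumed for transition matrices available for the explicit formula. -/
lemma isImpulsiveSolution_fundamentalMatrix [CompleteSpace 𝔸] (hθ : IsMomentSeq θ) (hab : Commute a b) (s : ℝ) :
    IsImpulsiveSolution (fun X => a * X) (fun X => b * X) θ (Ici s)
      (fun t => fundamentalMatrix θ a b t s) := by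
  have key : ∀ (m : ℕ) (t : ℝ), HasDerivAt (fun r => NormedSpace.exp ((r - s) • a) * (1 + b) ^ m)
      (a * (NormedSpace.exp ((t - s) • a) * (1 + b) ^ m)) t := by
    intro m t
    have h1 := (hasDerivAt_exp_smul_const' (𝕂 := ℝ) a (t - s)).comp_sub_const t s
    simpa [mul_assoc] using h1.mul_const ((1 + b) ^ m)
  refine ⟨fun t _ ht => ?_, fun i _ => ?_, fun i hi => ?_⟩
  · refine ((key _ t).congr_of_eventuallyEq ?_).hasDerivWithinAt
    filter_upwards [hθ.eventually_index_eq ht] with r hr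
    simp only [fundamentalMatrix, hr]
  · refine ((key _ (θ i)).hasDerivWithinAt.congr_of_eventuallyEq ?_ rfl).mono inter_subset_right
    filter_upwards [hθ.eventually_index_left i] with r hr
    simp only [fundamentalMatrix, hr, hθ.index_moment]
  · have hi' : momentIndex θ s ≤ i := hθ.index_le hi
    have h1 : (i + 1 - momentIndex θ s).toNat = (i - momentIndex θ s).toNat + 1 := by omega
    have h2 := ((key (i + 1 - momentIndex θ s).toNat (θ i)).continuousAt.tendsto).mono_left
      (nhdsWithin_le_nhds (s := Ioi (θ i)))
    have h3 : NormedSpace.exp ((θ i - s) • a) * (1 + b) ^ (i + 1 - momentIndex θ s).toNat =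
        fundamentalMatrix θ a b (θ i) s + b * fundamentalMatrix θ a b (θ i) s := by
      have hc : Commute (1 + b) (NormedSpace.exp ((θ i - s) • a)) :=
        (((Commute.one_right a).add_right hab).smul_left (θ i - s)).exp_left.symm
      rw [fundamentalMatrix, hθ.index_moment, h1, pow_succ', ← mul_assoc, ← hc.eq, mul_assoc,
        add_mul, one_mul]
    rw [h3] at h2
    refine h2.congr' ?_
    filter_upwards [hθ.eventually_index_right i] with r hr
    simp only [fundamentalMatrix, hr]

end FundamentalMatrix

/-! ### Variation of constants -/

section VariationOfConstants

variable {V : Type*} [NormedAddCommGroup V] [NormedSpace ℝ V]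
  {θ : ℤ → ℝ} {a b : V →L[ℝ] V}

/-- `y` solves `y' = a y + g`, `Δy = b y + p i` at `θ i`, on `[s, τ]`. -/
structure IsForcedSolution (a b : V →L[ℝ] V) (θ : ℤ → ℝ) (g : ℝ → V) (p : ℤ → V) (s τ : ℝ)
    (y : ℝ → V) : Prop where
  ode : ∀ t ∈ Icc s τ, t ∉ range θ → HasDerivWithinAt y (a (y t) + g t) (Icc s τ) t
  left : ∀ i, θ i ∈ Icc s τ → ContinuousWithinAt y (Icc s τ ∩ Iic (θ i)) (θ i)
  jump : ∀ i, θ i ∈ Ico s τ →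
    Tendsto y (𝓝[>] (θ i)) (𝓝 (y (θ i) + (b (y (θ i)) + p i)))

lemma IsForcedSolution.mono {g : ℝ → V} {p : ℤ → V} {s s' τ τ' : ℝ} {y : ℝ → V}
    (h : IsForcedSolution a b θ g p s τ y) (hs : s ≤ s') (hτ : τ' ≤ τ) :
    IsForcedSolution a b θ g p s' τ' y where
  ode t ht hr := (h.ode t (Icc_subset_Icc hs hτ ht) hr).mono (Icc_subset_Icc hs hτ)
  left i hi := (h.left i (Icc_subset_Icc hs hτ hi)).mono
    (inter_subset_inter_left _ (Icc_subset_Icc hs hτ))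
  jump i hi := h.jump i (Ico_subset_Ico hs hτ hi)

lemma IsForcedSolution.sub {g₁ g₂ : ℝ → V} {p₁ p₂ : ℤ → V} {s τ : ℝ} {y₁ y₂ : ℝ → V}
    (h₁ : IsForcedSolution a b θ g₁ p₁ s τ y₁) (h₂ : IsForcedSolution a b θ g₂ p₂ s τ y₂) :
    IsForcedSolution a b θ (fun t => g₁ t - g₂ t) (fun i => p₁ i - p₂ i) s τ
      (fun t => y₁ t - y₂ t) where
  ode t ht hr := ((h₁.ode t ht hr).sub (h₂.ode t ht hr)).congr_deriv (by rw [map_sub]; abel)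
  left i hi := (h₁.left i hi).sub (h₂.left i hi)
  jump i hi := by
    convert (h₁.jump i hi).sub (h₂.jump i hi) using 2
    rw [map_sub]; abel

/-- Freezing the nonlinear terms along a solution turns them into forcing of a linear equation;
differences of solutions are then handled by `IsForcedSolution.sub`. -/
lemma isForcedSolution_of_isImpulsiveSolution {f W : V → V} {D : Set ℝ} {y : ℝ → V}
    (hy : IsImpulsiveSolution (fun x => a x + f x) (fun x => b x + W x) θ D y) {s τ : ℝ}
    (hD : Icc s τ ⊆ D) :
    IsForcedSolution a b θ (fun t => f (y t)) (fun i => W (y (θ i))) s τ y where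
  ode t ht hr := (hy.ode t (hD ht) hr).mono hD
  left i hi := ((hy.ode_left i (hD hi)).continuousWithinAt).mono (inter_subset_inter_left _ hD)
  jump i hi := hy.jump i (hD (Ico_subset_Icc_self hi))

/-- Variation of constants, as an estimate by a scalar majorant `v`. -/
lemma IsForcedSolution.norm_sub_le [CompleteSpace V] (hθ : IsMomentSeq θ) (hab : Commute a b) {N ω : ℝ}
    (hZ : ∀ s t, s ≤ t → ‖fundamentalMatrix θ a b t s‖ ≤ N * Real.exp (-ω * (t - s)))
    {g : ℝ → V} {p : ℤ → V} {s τ : ℝ} {y : ℝ → V} (hy : IsForcedSolution a b θ g p s τ y)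
    (hst : s ≤ τ) {v v' : ℝ → ℝ} {q : ℤ → ℝ}
    (hv : ∀ t ∈ Icc s τ, t ∉ range θ → HasDerivWithinAt v (v' t) (Icc s τ) t)
    (hvl : ∀ i, θ i ∈ Icc s τ → ContinuousWithinAt v (Icc s τ ∩ Iic (θ i)) (θ i))
    (hvj : ∀ i, θ i ∈ Ico s τ → Tendsto v (𝓝[>] (θ i)) (𝓝 (v (θ i) + q i)))
    (hd : ∀ t ∈ Icc s τ, t ∉ range θ → N * Real.exp (-ω * (τ - t)) * ‖g t‖ ≤ v' t)
    (hj : ∀ i, θ i ∈ Ico s τ → N * Real.exp (-ω * (τ - θ i)) * ‖p i‖ ≤ q i) :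
    ‖y τ‖ ≤ N * Real.exp (-ω * (τ - s)) * ‖y s‖ + (v τ - v s) := by
  set Z : ℝ → V →L[ℝ] V := fun t => fundamentalMatrix θ a b τ t with hZdef
  -- `X m` is the smooth branch of `Z` on which `m` moments remain before `τ`. In the derivative of
  -- `Z t (y t)` the terms with `a` cancel and only `Z t (g t)` survives.
  set X : ℕ → ℝ → V →L[ℝ] V := fun m t => NormedSpace.exp ((τ - t) • a) * (1 + b) ^ m with hX
  have hXd : ∀ m t, HasDerivAt (X m) (-(X m t * a)) t := by
    intro m t
    have h1 := (hasDerivAt_exp_smul_const (𝕂 := ℝ) a (τ - t)).comp_const_sub τ t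
    have hc : Commute a ((1 + b) ^ m) := ((Commute.one_right a).add_right hab).pow_right m
    have h2 := h1.mul_const ((1 + b) ^ m)
    refine h2.congr_deriv ?_
    simp only [hX, neg_mul, mul_assoc, hc.eq]
  have hXc : ∀ m t, ContinuousAt (X m) t := fun m t => (hXd m t).continuousAt
  have main := norm_sub_le_sub_of_impulsive hθ (w := fun t => Z t (y t))
    (w' := fun t => Z t (g t)) (p := fun i => X (momentIndex θ τ - (i + 1)).toNat (θ i) (p i))
    hst ?_ ?_ ?_ hv hvl hvj ?_ ?_
  · simp only [hZdef, fundamentalMatrix_self, one_apply_eq_self] at main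
    have h1 : ‖fundamentalMatrix θ a b τ s (y s)‖ ≤ N * Real.exp (-ω * (τ - s)) * ‖y s‖ :=
      (ContinuousLinearMap.le_opNorm _ _).trans
        (mul_le_mul_of_nonneg_right (hZ s τ hst) (norm_nonneg _))
    have h2 := norm_le_norm_add_norm_sub' (y τ) (fundamentalMatrix θ a b τ s (y s))
    linarith
  · intro t ht hr
    have h1 := ((hXd (momentIndex θ τ - momentIndex θ t).toNat t).hasDerivWithinAt
      (s := Icc s τ)).clm_apply (hy.ode t ht hr)
    have h2 : HasDerivWithinAt (fun r => Z r (y r)) _ (Icc s τ) t :=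
      h1.congr_of_eventuallyEq (mem_nhdsWithin_of_mem_nhds <| by
        filter_upwards [hθ.eventually_index_eq hr] with r hr
        simp only [hZdef, hX, fundamentalMatrix, hr]) rfl
    refine h2.congr_deriv ?_
    have h3 : Z t = X (momentIndex θ τ - momentIndex θ t).toNat t := rfl
    rw [← h3]
    generalize Z t = T
    change -(T (a (y t))) + T (a (y t) + g t) = T (g t)
    rw [map_add]; abel
  · intro i hi
    have h1 := ((hXc (momentIndex θ τ - i).toNat (θ i)).continuousWithinAt
      (s := Icc s τ ∩ Iic (θ i))).clm_apply (hy.left i hi)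
    refine h1.congr_of_eventuallyEq (nhdsWithin_mono _ inter_subset_right ?_) ?_
    · filter_upwards [hθ.eventually_index_left i] with r hr
      simp only [hZdef, hX, fundamentalMatrix, hr]
    · simp only [hZdef, hX, fundamentalMatrix, hθ.index_moment]
  · intro i hi
    set m := (momentIndex θ τ - (i + 1)).toNat with hm
    have hlt := hθ.lt_index hi.2
    have hm' : (momentIndex θ τ - i).toNat = m + 1 := by omega
    have h0 : Tendsto (X m) (𝓝[>] (θ i)) (𝓝 (X m (θ i))) :=
      (hXc m (θ i)).tendsto.mono_left nhdsWithin_le_nhds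
    have h1 := ((isBoundedBilinearMap_apply (𝕜 := ℝ) (E := V) (F := V)).continuous.tendsto
      (X m (θ i), y (θ i) + (b (y (θ i)) + p i))).comp (h0.prodMk_nhds (hy.jump i hi))
    have h2 : Z (θ i) (y (θ i)) + X m (θ i) (p i) =
        X m (θ i) (y (θ i) + (b (y (θ i)) + p i)) := by
      -- Passing `θ i` removes one factor `1 + b` from `Z`, which compensates the linear part of the
      -- jump of `y`.
      have h3 : Z (θ i) = X m (θ i) * (1 + b) := by
        simp only [hZdef, hX, fundamentalMatrix, hθ.index_moment, hm', pow_succ, mul_assoc]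
      rw [h3, ← add_assoc, map_add]
      rfl
    rw [h2]
    refine h1.congr' ?_
    filter_upwards [hθ.eventually_index_right i] with r hr
    simp only [hZdef, hX, fundamentalMatrix, hr, hm, Function.comp_apply]
  · intro t ht hr
    refine (ContinuousLinearMap.le_opNorm _ _).trans (le_trans ?_ (hd t ht hr))
    exact mul_le_mul_of_nonneg_right (hZ t τ ht.2) (norm_nonneg _)
  · intro i hi
    refine (ContinuousLinearMap.le_opNorm _ _).trans (le_trans ?_ (hj i hi))
    refine mul_le_mul_of_nonneg_right ?_ (norm_nonneg _)
    -- `X m (θ i)` is a right limit of `Z`, not a value of it, so the decay bound is obtained by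
    -- passing to the limit from the right.
    have h1 := ((hXc (momentIndex θ τ - (i + 1)).toNat (θ i)).tendsto.mono_left
      (nhdsWithin_le_nhds (s := Ioi (θ i)))).norm
    have h2 : Tendsto (fun r => N * Real.exp (-ω * (τ - r))) (𝓝[>] (θ i))
        (𝓝 (N * Real.exp (-ω * (τ - θ i)))) :=
      (Continuous.tendsto (by fun_prop) _).mono_left nhdsWithin_le_nhds
    refine le_of_tendsto_of_tendsto h1 h2 ?_
    filter_upwards [hθ.eventually_index_right i, Ioo_mem_nhdsGT hi.2] with r hr hr2
    have := hZ r τ hr2.2.le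
    simpa only [fundamentalMatrix, hr] using this

end VariationOfConstants

/-! ### Scalar majorants with jumps -/

section IndexedFunctions

variable {θ : ℤ → ℝ} {ψ ψ' : ℤ → ℝ → ℝ}

/-- The majorants have the form `ψ (momentIndex θ r) r`: smooth branches, with the jump `ψ (i + 1) -
ψ i` at `θ i`. This lemma and the next two supply the regularity that `IsForcedSolution.norm_sub_le`
asks for. -/
lemma hasDerivWithinAt_indexed (hθ : IsMomentSeq θ) (hψ : ∀ k t, HasDerivAt (ψ k) (ψ' k t) t)
    (D : Set ℝ) (t : ℝ) (ht : t ∉ range θ) :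
    HasDerivWithinAt (fun r => ψ (momentIndex θ r) r) (ψ' (momentIndex θ t) t) D t := by
  refine ((hψ (momentIndex θ t) t).congr_of_eventuallyEq ?_).hasDerivWithinAt
  filter_upwards [hθ.eventually_index_eq ht] with r hr
  simp only [hr]

lemma continuousWithinAt_indexed (hθ : IsMomentSeq θ) (hψ : ∀ k t, HasDerivAt (ψ k) (ψ' k t) t)
    (D : Set ℝ) (i : ℤ) :
    ContinuousWithinAt (fun r => ψ (momentIndex θ r) r) (D ∩ Iic (θ i)) (θ i) := by
  refine ((hψ i (θ i)).continuousAt.continuousWithinAt).congr_of_eventuallyEq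
    (nhdsWithin_mono _ inter_subset_right ?_) ?_
  · filter_upwards [hθ.eventually_index_left i] with r hr
    simp only [hr]
  · simp only [hθ.index_moment]

lemma tendsto_indexed (hθ : IsMomentSeq θ) (hψ : ∀ k t, HasDerivAt (ψ k) (ψ' k t) t) (i : ℤ) :
    Tendsto (fun r => ψ (momentIndex θ r) r) (𝓝[>] (θ i))
      (𝓝 (ψ (momentIndex θ (θ i)) (θ i) + (ψ (i + 1) (θ i) - ψ i (θ i)))) := by
  rw [hθ.index_moment, add_sub_cancel]
  refine ((hψ (i + 1) (θ i)).continuousAt.tendsto.mono_left nhdsWithin_le_nhds).congr' ?_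
  filter_upwards [hθ.eventually_index_right i] with r hr
  simp only [hr]

end IndexedFunctions

/-! ### Boundedness and Gronwall estimates -/

section Estimates

variable {V : Type*} [NormedAddCommGroup V] [NormedSpace ℝ V] [CompleteSpace V]
  {θ : ℤ → ℝ} {a b : V →L[ℝ] V} {N ω : ℝ} {g : ℝ → V} {p : ℤ → V} {s τ : ℝ} {y : ℝ → V}

/-- Ultimate boundedness under a bounded forcing. -/
lemma IsForcedSolution.norm_le_of_bounded (hθ : IsMomentSeq θ) (hab : Commute a b) (hN : 0 < N)
    (hω : 0 < ω)
    (hZ : ∀ s t, s ≤ t → ‖fundamentalMatrix θ a b t s‖ ≤ N * Real.exp (-ω * (t - s)))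
    (hy : IsForcedSolution a b θ g p s τ y) (hst : s ≤ τ) {Mg Mp : ℝ}
    (hg : ∀ t, ‖g t‖ ≤ Mg) (hp : ∀ i, ‖p i‖ ≤ Mp) :
    ‖y τ‖ ≤ N * Real.exp (-ω * (τ - s)) * ‖y s‖ +
      N * (Mg / ω + Mp * Real.exp ω / (1 - Real.exp (-ω))) := by
  have hMg : 0 ≤ Mg := (norm_nonneg _).trans (hg 0)
  have hMp : 0 ≤ Mp := (norm_nonneg _).trans (hp 0)
  have hpos : 0 < 1 - Real.exp (-ω) := by
    have := Real.exp_lt_one_iff.2 (neg_lt_zero.2 hω); linarith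
  set K := N * Mp / (1 - Real.exp (-ω)) with hK
  have hK0 : 0 ≤ K := by positivity
  -- The first term is a primitive of the bound for the continuous forcing. The second telescopes a
  -- geometric series: its increment at the `i`-th moment is `N * Mp * exp (-ω (τ - (i + 1)))`,
  -- enough because `θ i ≤ i + 1`.
  set ψ : ℤ → ℝ → ℝ := fun k r => N * Mg / ω * Real.exp (-ω * (τ - r)) +
    K * Real.exp (-ω * (τ - k)) with hψ
  have hψd : ∀ k t, HasDerivAt (ψ k) (N * Mg * Real.exp (-ω * (τ - t))) t := by
    intro k t
    have h1 : HasDerivAt (fun r => -ω * (τ - r)) ω t := by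
      simpa using ((hasDerivAt_id t).const_sub τ).const_mul (-ω)
    have h2 := (h1.exp.const_mul (N * Mg / ω)).add_const (K * Real.exp (-ω * (τ - k)))
    refine h2.congr_deriv ?_
    field_simp
  have main := hy.norm_sub_le hθ hab hZ hst (fun t _ ht => hasDerivWithinAt_indexed hθ hψd _ t ht)
    (fun i _ => continuousWithinAt_indexed hθ hψd _ i) (fun i _ => tendsto_indexed hθ hψd i) ?_ ?_
  · refine main.trans (add_le_add le_rfl ?_)
    have h0 : 0 ≤ ψ (momentIndex θ s) s := by positivity
    have h1 : Real.exp (-ω * (τ - momentIndex θ τ)) ≤ Real.exp ω := by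
      have := hθ.index_lt_add_one τ
      exact Real.exp_le_exp.2 (by nlinarith)
    have h2 : ψ (momentIndex θ τ) τ ≤ N * (Mg / ω + Mp * Real.exp ω / (1 - Real.exp (-ω))) := by
      have h3 := mul_le_mul_of_nonneg_left h1 hK0
      simp only [hψ, sub_self, mul_zero, Real.exp_zero, mul_one]
      calc _ ≤ N * Mg / ω + K * Real.exp ω := by linarith
        _ = _ := by rw [hK]; ring
    linarith
  · intro t _ _
    calc N * Real.exp (-ω * (τ - t)) * ‖g t‖ ≤ N * Real.exp (-ω * (τ - t)) * Mg := by
          gcongr; exact hg t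
      _ = _ := by ring
  · intro i hi
    have h1 : Real.exp (-ω * (τ - θ i)) ≤ Real.exp (-ω * (τ - (i + 1))) := by
      have := hθ.moment_le i
      exact Real.exp_le_exp.2 (by nlinarith)
    have h2 : Real.exp (-ω * (τ - i)) = Real.exp (-ω * (τ - (i + 1))) * Real.exp (-ω) := by
      rw [← Real.exp_add]; congr 1; ring
    simp only [hψ]
    push_cast
    calc N * Real.exp (-ω * (τ - θ i)) * ‖p i‖ ≤ N * Real.exp (-ω * (τ - (i + 1))) * Mp := by
          gcongr; exact hp i
      _ = K * (1 - Real.exp (-ω)) * Real.exp (-ω * (τ - (i + 1))) := by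
          rw [hK]; field_simp
      _ = _ := by rw [h2]; ring

/-- Impulsive Gronwall estimate. -/
lemma IsForcedSolution.norm_le_of_lipschitz (hθ : IsMomentSeq θ) (hab : Commute a b) (hN : 0 < N)
    (hZ : ∀ s t, s ≤ t → ‖fundamentalMatrix θ a b t s‖ ≤ N * Real.exp (-ω * (t - s)))
    (hy : IsForcedSolution a b θ g p s τ y) (hst : s ≤ τ) {L C : ℝ} (hL : 0 ≤ L)
    (hg : ∀ t ∈ Icc s τ, ‖g t‖ ≤ L * ‖y t‖) (hp : ∀ i, θ i ∈ Ico s τ → ‖p i‖ ≤ L * ‖y (θ i)‖)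
    (hC : ∀ t ∈ Icc s τ, ‖y t‖ ≤ C) :
    ‖y τ‖ ≤ N * ‖y s‖ * Real.exp ((-ω + N * L) * (τ - s)) *
      (1 + N * L) ^ (momentIndex θ τ - momentIndex θ s) := by
  set κ := N * L with hκ
  have hκ0 : 0 ≤ κ := by positivity
  have hκ1 : 0 < 1 + κ := by positivity
  set u : ℝ → ℝ := fun t => Real.exp (ω * (t - s)) * ‖y t‖ with hu
  -- `U` is the extremal Gronwall function: `U' = κ U`, jumps `κ U`, and `U s = 1`.
  set U : ℝ → ℝ := fun t => Real.exp (κ * (t - s)) * (1 + κ) ^ (momentIndex θ t - momentIndex θ s)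
    with hU
  have hU1 : ∀ t ∈ Icc s τ, 1 ≤ U t := fun t ht =>
    one_le_mul_of_one_le_of_one_le (Real.one_le_exp (mul_nonneg hκ0 (by linarith [ht.1])))
      (one_le_zpow₀ (by linarith) (by have := hθ.index_mono ht.1; omega))
  have hUmono : ∀ t ∈ Icc s τ, U t ≤ U τ := by
    intro t ht
    have h1 := hθ.index_mono ht.2
    refine mul_le_mul (Real.exp_le_exp.2 (mul_le_mul_of_nonneg_left (by linarith [ht.2]) hκ0))
      (zpow_le_zpow_right₀ (by linarith) (by omega)) (by positivity) (by positivity)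
  -- One Picard iteration: a bound `ρ U` fed into the forcing returns with `ρ (U - 1)` in place of
  -- `ρ U`.
  have step : ∀ ρ, ∀ t ∈ Icc s τ, (∀ r ∈ Icc s τ, u r ≤ ρ * U r) →
      u t ≤ N * ‖y s‖ + ρ * (U t - 1) := by
    intro ρ t ht hρ
    set ψ : ℤ → ℝ → ℝ := fun k r => Real.exp (-ω * (t - s)) * ρ *
      (Real.exp (κ * (r - s)) * (1 + κ) ^ (k - momentIndex θ s)) with hψ
    have hψd : ∀ k r, HasDerivAt (ψ k) (κ * ψ k r) r := by
      intro k r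
      have h1 : HasDerivAt (fun r => κ * (r - s)) κ r := by
        simpa using ((hasDerivAt_id r).sub_const s).const_mul κ
      have h2 := (h1.exp.mul_const ((1 + κ) ^ (k - momentIndex θ s))).const_mul
        (Real.exp (-ω * (t - s)) * ρ)
      refine h2.congr_deriv ?_
      simp only [hψ]; ring
    have hbound : ∀ r ∈ Icc s t, N * Real.exp (-ω * (t - r)) * (L * ‖y r‖) ≤
        κ * (Real.exp (-ω * (t - s)) * ρ * U r) := by
      intro r hr
      have h1 : Real.exp (-ω * (t - r)) = Real.exp (-ω * (t - s)) * Real.exp (ω * (r - s)) := by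
        rw [← Real.exp_add]; congr 1; ring
      have h2 := mul_le_mul_of_nonneg_left (hρ r ⟨hr.1, hr.2.trans ht.2⟩)
        (mul_nonneg hκ0 (Real.exp_pos (-ω * (t - s))).le)
      calc _ = κ * Real.exp (-ω * (t - s)) * u r := by rw [h1, hκ]; ring
        _ ≤ _ := h2
        _ = _ := by ring
    have main := (hy.mono le_rfl ht.2).norm_sub_le hθ hab hZ ht.1
      (fun r _ hr => hasDerivWithinAt_indexed hθ hψd _ r hr)
      (fun i _ => continuousWithinAt_indexed hθ hψd _ i) (fun i _ => tendsto_indexed hθ hψd i)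
      ?_ ?_
    · have h1 := mul_le_mul_of_nonneg_left main (Real.exp_pos (ω * (t - s))).le
      have h2 : Real.exp (ω * (t - s)) * Real.exp (-ω * (t - s)) = 1 := by
        rw [← Real.exp_add]; simp
      have hs1 : U s = 1 := by simp [hU]
      calc u t ≤ _ := h1
        _ = Real.exp (ω * (t - s)) * Real.exp (-ω * (t - s)) *
            (N * ‖y s‖ + ρ * (U t - U s)) := by simp only [hψ, hU]; ring
        _ = _ := by rw [h2, one_mul, hs1]
    · intro r hr _
      refine le_trans ?_ (hbound r hr)
      have := hg r ⟨hr.1, hr.2.trans ht.2⟩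
      gcongr
    · intro i hi
      refine le_trans ?_ ((hbound (θ i) (Ico_subset_Icc_self hi)).trans_eq ?_)
      · have := hp i ⟨hi.1, hi.2.trans_le ht.2⟩
        gcongr
      · have h1 : (1 + κ) ^ (i + 1 - momentIndex θ s) =
            (1 + κ) ^ (i - momentIndex θ s) * (1 + κ) := by
          rw [← zpow_add_one₀ hκ1.ne']; congr 1; ring
        simp only [hψ, hU, hθ.index_moment, h1]
        ring
  -- The `ε` keeps the normalising constant `c` positive even when `y s = 0`.
  have final : ∀ ε > 0, u τ ≤ (N * ‖y s‖ + ε) * U τ := by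
    intro ε hε
    set c := N * ‖y s‖ + ε with hc
    have hc0 : 0 < c := by positivity
    have hne : (Icc s τ).Nonempty := ⟨s, left_mem_Icc.2 hst⟩
    have hUτ : 1 ≤ U τ := hU1 τ (right_mem_Icc.2 hst)
    have hbdd : BddAbove ((fun t => u t / (c * U t)) '' Icc s τ) := by
      refine ⟨Real.exp (|ω| * (τ - s)) * C / c, ?_⟩
      rintro _ ⟨t, ht, rfl⟩
      have h1 : u t ≤ Real.exp (|ω| * (τ - s)) * C := by
        have h2 : ω * (t - s) ≤ |ω| * (τ - s) :=
          mul_le_mul (le_abs_self _) (by linarith [ht.2]) (by linarith [ht.1]) (abs_nonneg _)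
        exact mul_le_mul (Real.exp_le_exp.2 h2) (hC t ht) (norm_nonneg _) (Real.exp_pos _).le
      have h3 : 0 ≤ u t := by positivity
      have h4 := hU1 t ht
      exact div_le_div₀ (h3.trans h1) h1 hc0 (le_mul_of_one_le_right hc0.le h4)
    set ρ := sSup ((fun t => u t / (c * U t)) '' Icc s τ) with hρ
    have hle : ∀ t ∈ Icc s τ, u t ≤ ρ * c * U t := by
      intro t ht
      have h1 := le_csSup hbdd (mem_image_of_mem _ ht)
      have h2 : 0 < c * U t := mul_pos hc0 (by linarith [hU1 t ht])
      have := (div_le_iff₀ h2).1 h1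
      linarith
    have hρ1 : ρ ≤ 1 := by
      by_contra! hlt
      -- `ρ` is the best constant in `u ≤ ρ c U`, finite because `y` is bounded by `C`. If it
      -- exceeded `1`, one iteration would improve it by `(ρ - 1) / U τ`.
      have hcontra : ρ ≤ ρ - (ρ - 1) / U τ := by
        refine csSup_le (hne.image _) ?_
        rintro _ ⟨t, ht, rfl⟩
        have h1 := step (ρ * c) t ht hle
        have h4 := hU1 t ht
        have h5 := hUmono t ht
        have h2 : 0 < c * U t := mul_pos hc0 (by linarith)
        refine (div_le_iff₀ h2).2 ?_
        have h6 : (ρ - 1) * (U t / U τ) ≤ (ρ - 1) * 1 :=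
          mul_le_mul_of_nonneg_left ((div_le_one (by linarith)).2 h5) (by linarith)
        have h7 : (ρ - (ρ - 1) / U τ) * (c * U t) =
            c * (ρ * U t) - c * ((ρ - 1) * (U t / U τ)) := by ring
        have h8 := mul_le_mul_of_nonneg_left h6 hc0.le
        have h9 : N * ‖y s‖ ≤ c := by linarith
        rw [h7]
        nlinarith
      have : 0 < (ρ - 1) / U τ := div_pos (by linarith) (by linarith)
      linarith
    refine (hle τ (right_mem_Icc.2 hst)).trans ?_
    gcongr
    nlinarith
  have h1 : u τ ≤ N * ‖y s‖ * U τ := by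
    refine le_of_tendsto_of_tendsto (f := fun _ : ℝ => u τ)
      (g := fun ε => (N * ‖y s‖ + ε) * U τ) (b := 𝓝[>] (0 : ℝ)) tendsto_const_nhds ?_ ?_
    · have : Continuous fun ε => (N * ‖y s‖ + ε) * U τ := by fun_prop
      simpa using (this.tendsto 0).mono_left (nhdsWithin_le_nhds (s := Ioi (0 : ℝ)))
    · filter_upwards [self_mem_nhdsWithin] with ε hε using final ε hε
  have h2 : Real.exp (-ω * (τ - s)) * Real.exp (ω * (τ - s)) = 1 := by
    rw [← Real.exp_add]; simp
  calc ‖y τ‖ = Real.exp (-ω * (τ - s)) * u τ := by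
        simp only [hu, ← mul_assoc, h2, one_mul]
    _ ≤ Real.exp (-ω * (τ - s)) * (N * ‖y s‖ * U τ) := by gcongr
    _ = _ := by
      rw [show (-ω + κ) * (τ - s) = -ω * (τ - s) + κ * (τ - s) by ring, Real.exp_add]
      simp only [hU]; ring

/-- Exponential contraction under a forcing with a small Lipschitz constant. -/
lemma IsForcedSolution.norm_le_exp (hθ : IsMomentSeq θ) (hab : Commute a b) (hN : 0 < N)
    (hZ : ∀ s t, s ≤ t → ‖fundamentalMatrix θ a b t s‖ ≤ N * Real.exp (-ω * (t - s)))
    (hy : IsForcedSolution a b θ g p s τ y) (hst : s ≤ τ) {L C : ℝ} (hL : 0 ≤ L)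
    (hg : ∀ t ∈ Icc s τ, ‖g t‖ ≤ L * ‖y t‖) (hp : ∀ i, θ i ∈ Ico s τ → ‖p i‖ ≤ L * ‖y (θ i)‖)
    (hC : ∀ t ∈ Icc s τ, ‖y t‖ ≤ C) :
    ‖y τ‖ ≤ N * (1 + N * L) ^ (2 : ℕ) *
      Real.exp (-(-(-ω + N * L + Real.log (1 + N * L))) * (τ - s)) * ‖y s‖ := by
  refine (hy.norm_le_of_lipschitz hθ hab hN hZ hst hL hg hp hC).trans ?_
  have hκ1 : 1 ≤ 1 + N * L := by have := mul_nonneg hN.le hL; linarith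
  have hκ0 : 0 < 1 + N * L := by linarith
  -- There are at most `τ - s + 2` moments in `[s, τ)`; the excess `2` is the source of the squared
  -- factor.
  have h1 : (1 + N * L) ^ (momentIndex θ τ - momentIndex θ s) ≤
      Real.exp (Real.log (1 + N * L) * (τ - s)) * (1 + N * L) ^ (2 : ℕ) := by
    rw [← Real.rpow_def_of_pos hκ0, ← Real.rpow_natCast, ← Real.rpow_add hκ0,
      ← Real.rpow_intCast]
    refine Real.rpow_le_rpow_of_exponent_le hκ1 ?_
    have h2 := hθ.index_lt_add_one τ
    have h3 := hθ.sub_one_le_index s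
    push_cast
    linarith
  calc _ ≤ N * ‖y s‖ * Real.exp ((-ω + N * L) * (τ - s)) *
        (Real.exp (Real.log (1 + N * L) * (τ - s)) * (1 + N * L) ^ (2 : ℕ)) := by gcongr
    _ = _ := by
      rw [show -(-(-ω + N * L + Real.log (1 + N * L))) * (τ - s) =
        (-ω + N * L) * (τ - s) + Real.log (1 + N * L) * (τ - s) by ring, Real.exp_add]
      ring

end Estimates

/-! ### The flow between impulses -/

section Flow

open scoped NNReal

variable {V : Type*} [NormedAddCommGroup V] [NormedSpace ℝ V]

/-- Gronwall for positive times; negative times follow by applying it to the reversed field `-F`. -/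
lemma dist_le_of_hasDerivAt_lipschitz {F : V → V} {K : ℝ≥0} (hF : LipschitzWith K F) {α β : ℝ → V}
    (hα : ∀ t, HasDerivAt α (F (α t)) t) (hβ : ∀ t, HasDerivAt β (F (β t)) t) (t : ℝ) :
    dist (α t) (β t) ≤ dist (α 0) (β 0) * Real.exp (K * |t|) := by
  have pos : ∀ {G : V → V}, LipschitzWith K G → ∀ {α β : ℝ → V},
      (∀ t, HasDerivAt α (G (α t)) t) → (∀ t, HasDerivAt β (G (β t)) t) → ∀ t, 0 ≤ t →
      dist (α t) (β t) ≤ dist (α 0) (β 0) * Real.exp (K * t) := by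
    intro G hG α β hα hβ t ht
    have := dist_le_of_trajectories_ODE (v := fun _ => G) (fun _ => hG) (a := 0) (b := t)
      (fun r _ => (hα r).continuousAt.continuousWithinAt) (fun r _ => (hα r).hasDerivWithinAt)
      (fun r _ => (hβ r).continuousAt.continuousWithinAt) (fun r _ => (hβ r).hasDerivWithinAt)
      le_rfl t (right_mem_Icc.2 ht)
    simpa using this
  rcases le_total 0 t with ht | ht
  · rw [abs_of_nonneg ht]; exact pos hF hα hβ t ht
  · have neg : ∀ {α : ℝ → V}, (∀ t, HasDerivAt α (F (α t)) t) →
        ∀ t, HasDerivAt (fun r => α (-r)) (-F (α (-t))) t := fun hα t => by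
      simpa [Function.comp_def] using (hα (-t)).scomp t (hasDerivAt_neg t)
    have := pos (G := fun x => -F x) hF.neg (neg hα) (neg hβ) (-t) (by linarith)
    rw [abs_of_nonpos ht]
    simpa using this

variable [CompleteSpace V]

/-- Solutions of `z' = a z + f z` with `f` Lipschitz and bounded exist on every interval. -/
lemma exists_solution_Ioo (a : V →L[ℝ] V) {f : V → V} {K : ℝ≥0} (hf : LipschitzWith K f) {M : ℝ}
    (hM : ∀ x, ‖f x‖ ≤ M) (x : V) {T : ℝ} (hT : 0 < T) :
    ∃ α : ℝ → V, α 0 = x ∧ ∀ t ∈ Ioo (-T) T, HasDerivAt α (a (α t) + f (α t)) t := by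
  set U : ℝ → V →L[ℝ] V := fun t => NormedSpace.exp (t • a) with hU
  have hUd : ∀ t, HasDerivAt U (a * U t) t := fun t => hasDerivAt_exp_smul_const' (𝕂 := ℝ) a t
  have hUc : Continuous U := continuous_iff_continuousAt.2 fun t => (hUd t).continuousAt
  have hUU : ∀ t, U t * U (-t) = 1 := by
    intro t
    let _ : NormedAlgebra ℚ (V →L[ℝ] V) := NormedAlgebra.restrictScalars ℚ ℝ _
    simp only [hU]
    rw [← NormedSpace.exp_add_of_commute (((Commute.refl a).smul_left t).smul_right (-t)),
      ← add_smul]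
    simp
  obtain ⟨C, hC⟩ : ∃ C, ∀ t ∈ Icc (-T) T, ‖U t‖ ≤ C :=
    isCompact_Icc.exists_bound_of_continuousOn hUc.continuousOn
  have hC0 : 0 ≤ C := (norm_nonneg _).trans (hC 0 ⟨by linarith, hT.le⟩)
  have hM0 : 0 ≤ M := (norm_nonneg _).trans (hM 0)
  have hneg : ∀ t ∈ Icc (-T) T, -t ∈ Icc (-T) T := fun t ht => ⟨by linarith [ht.2], by linarith [ht.1]⟩
  -- The substitution `α = U w` removes the linear part. The remaining field is bounded by `C * M`,
  -- so a ball of radius `C * M * T` contains the solution for the whole time and no smallness of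
  -- `T` is needed.
  have hPL : IsPicardLindelof (fun t w => U (-t) (f (U t w))) (tmin := -T) (tmax := T)
      ⟨0, by linarith, hT.le⟩ x (Real.toNNReal (C * M * T)) 0 (Real.toNNReal (C * M))
      (Real.toNNReal C * (K * Real.toNNReal C)) := by
    refine ⟨fun t ht => ?_, fun w _ => ?_, fun t ht w _ => ?_, ?_⟩
    · have lip : ∀ r ∈ Icc (-T) T, LipschitzWith (Real.toNNReal C) (U r) := fun r hr =>
        (U r).lipschitz.weaken (by
          rw [← NNReal.coe_le_coe, Real.coe_toNNReal _ hC0]; exact hC r hr)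
      exact ((lip (-t) (hneg t ht)).comp (hf.comp (lip t ht))).lipschitzOnWith
    · have h1 : Continuous fun t => U t w := hUc.clm_apply continuous_const
      exact ((hUc.comp continuous_neg).clm_apply (hf.continuous.comp h1)).continuousOn
    · rw [Real.coe_toNNReal _ (by positivity)]
      exact (ContinuousLinearMap.le_opNorm _ _).trans
        (mul_le_mul (hC _ (hneg t ht)) (hM _) (norm_nonneg _) hC0)
    · rw [Real.coe_toNNReal _ (by positivity), Real.coe_toNNReal _ (by positivity)]
      simp
  obtain ⟨w, hw0, hw⟩ := hPL.exists_eq_forall_mem_Icc_hasDerivWithinAt₀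
  refine ⟨fun t => U t (w t), ?_, fun t ht => ?_⟩
  · change U 0 (w 0) = x
    have : w 0 = x := hw0
    simp [hU, this]
  · have h1 := (hw t (Ioo_subset_Icc_self ht)).hasDerivAt (Icc_mem_nhds ht.1 ht.2)
    have h2 := (hUd t).clm_apply h1
    refine h2.congr_deriv ?_
    have h3 : U t (U (-t) (f (U t (w t)))) = (U t * U (-t)) (f (U t (w t))) := rfl
    rw [h3, hUU]
    rfl

/-- `φ` is the (global, jointly continuous) flow of `z' = F z`. -/
structure IsFlowOf (F : V → V) (φ : ℝ → V → V) : Prop where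
  zero : ∀ x, φ 0 x = x
  hasDerivAt : ∀ x t, HasDerivAt (fun r => φ r x) (F (φ t x)) t
  continuous : Continuous fun p : ℝ × V => φ p.1 p.2

/-- Solutions on `(-T, T)` agree for different `T` by uniqueness, so the value at `t` may be read
off from `T = |t| + 1`. Joint continuity combines continuity in time with the Lipschitz dependence
on the initial value, uniform on bounded times. -/
lemma exists_isFlowOf (a : V →L[ℝ] V) {f : V → V} {K : ℝ≥0} (hf : LipschitzWith K f) {M : ℝ}
    (hM : ∀ x, ‖f x‖ ≤ M) : ∃ φ : ℝ → V → V, IsFlowOf (fun x => a x + f x) φ := by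
  have hF : LipschitzWith (‖a‖₊ + K) fun x => a x + f x := a.lipschitz.add hf
  choose! α hα0 hα using fun (x : V) (T : ℝ) (hT : 0 < T) => exists_solution_Ioo a hf hM x hT
  have hpos : ∀ t : ℝ, 0 < |t| + 1 := fun t => by positivity
  have heq : ∀ x T T', 0 < T → T ≤ T' → EqOn (α x T) (α x T') (Ioo (-T) T) := by
    intro x T T' hT hTT'
    have hT' := hT.trans_le hTT'
    exact ODE_solution_unique_of_mem_Ioo (v := fun _ z => a z + f z) (s := fun _ => univ) (t₀ := 0)
      (fun _ _ => hF.lipschitzOnWith) ⟨by linarith, hT⟩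
      (fun t ht => ⟨hα x T hT t ht, trivial⟩)
      (fun t ht => ⟨hα x T' hT' t ⟨by linarith [ht.1], by linarith [ht.2]⟩, trivial⟩)
      ((hα0 x T hT).trans (hα0 x T' hT').symm)
  have hzero : ∀ x, α x (|(0 : ℝ)| + 1) 0 = x := fun x => hα0 x _ (hpos 0)
  have hder : ∀ x t, HasDerivAt (fun r => α x (|r| + 1) r)
      (a (α x (|t| + 1) t) + f (α x (|t| + 1) t)) t := by
    intro x t
    have ht1 : t ∈ Ioo (-(|t| + 1)) (|t| + 1) := abs_lt.1 (lt_add_one _)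
    have ht2 : t ∈ Ioo (-(|t| + 2)) (|t| + 2) := abs_lt.1 (by linarith)
    have h1 := hα x (|t| + 2) (by positivity) t ht2
    have h2 := heq x (|t| + 1) (|t| + 2) (hpos t) (by linarith) ht1
    rw [← h2] at h1
    refine h1.congr_of_eventuallyEq ?_
    have h3 : ∀ᶠ r in 𝓝 t, |r| < |t| + 1 := continuous_abs.continuousAt.eventually_lt_const (lt_add_one _)
    filter_upwards [h3] with r hr
    exact heq x (|r| + 1) (|t| + 2) (hpos r) (by linarith) (abs_lt.1 (lt_add_one _))
  refine ⟨fun t x => α x (|t| + 1) t, hzero, hder, ?_⟩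
  refine continuous_iff_continuousAt.2 fun ⟨t, x⟩ => ?_
  set T := |t| + 1
  have hon : ContinuousOn (fun p : ℝ × V => α p.2 (|p.1| + 1) p.1) (Icc (-T) T ×ˢ univ) := by
    refine continuousOn_prod_of_continuousOn_lipschitzOnWith' _
      (Real.toNNReal (Real.exp ((‖a‖₊ + K : ℝ≥0) * T))) (fun r hr => ?_) fun z _ r _ =>
      (hder z r).continuousAt.continuousWithinAt
    refine LipschitzOnWith.of_dist_le_mul fun z₁ _ z₂ _ => ?_
    have h1 := dist_le_of_hasDerivAt_lipschitz hF (hder z₁) (hder z₂) r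
    rw [hzero, hzero] at h1
    rw [Real.coe_toNNReal _ (Real.exp_pos _).le, mul_comm]
    refine h1.trans (mul_le_mul_of_nonneg_left (Real.exp_le_exp.2 ?_) dist_nonneg)
    exact mul_le_mul_of_nonneg_left (abs_le.2 hr) (NNReal.coe_nonneg _)
  have hmem := abs_lt.1 (lt_add_one |t|)
  exact hon.continuousAt (prod_mem_nhds (Icc_mem_nhds hmem.1 hmem.2) univ_mem)

end Flow

/-! ### Gluing pieces of the flow at the moments -/

section GlueFlow

variable {V : Type*} [NormedAddCommGroup V] {θ : ℤ → ℝ} {G : V → V} {φ : ℝ → V → V}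

/-- The function which takes the value `x i` at `θ i` and follows the flow `φ` between the moments. -/
noncomputable def glueFlow (θ : ℤ → ℝ) (G : V → V) (φ : ℝ → V → V) (x : ℤ → V) (t : ℝ) : V :=
  open Classical in
  if t = θ (momentIndex θ t) then x (momentIndex θ t) else
    φ (t - θ (momentIndex θ t - 1)) (x (momentIndex θ t - 1) + G (x (momentIndex θ t - 1)))

lemma glueFlow_moment (hθ : IsMomentSeq θ) (x : ℤ → V) (i : ℤ) :
    glueFlow θ G φ x (θ i) = x i := by
  simp [glueFlow, hθ.index_moment]

lemma glueFlow_of_mem_Ioo (hθ : IsMomentSeq θ) (x : ℤ → V) {i : ℤ} {t : ℝ}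
    (ht : t ∈ Ioo (θ (i - 1)) (θ i)) :
    glueFlow θ G φ x t = φ (t - θ (i - 1)) (x (i - 1) + G (x (i - 1))) := by
  rw [glueFlow, hθ.index_eq ht.1 ht.2.le, if_neg ht.2.ne]

end GlueFlow

section Gluing

variable {V : Type*} [NormedAddCommGroup V] [NormedSpace ℝ V] {θ : ℤ → ℝ} {F G : V → V}
  {φ : ℝ → V → V} {D : Set ℝ} {z : ℝ → V}

lemma IsImpulsiveSolution.mono {D' : Set ℝ} (hz : IsImpulsiveSolution F G θ D z) (h : D' ⊆ D) :
    IsImpulsiveSolution F G θ D' z where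
  ode t ht hr := (hz.ode t (h ht) hr).mono h
  ode_left i hi := (hz.ode_left i (h hi)).mono (inter_subset_inter_left _ h)
  jump i hi := hz.jump i (h hi)

lemma IsFlowOf.hasDerivAt_sub (hφ : IsFlowOf F φ) (x : V) (s t : ℝ) :
    HasDerivAt (fun r => φ (r - s) x) (F (φ (t - s) x)) t :=
  (hφ.hasDerivAt x (t - s)).comp_sub_const t s

/-- Jumps and the equation off the moments hold by construction; only left differentiability at `θ
i` requires the recursion for `x`. It is vacuous when `D` starts at `θ i`, which serves half-lines.
-/
lemma isImpulsiveSolution_glueFlow (hθ : IsMomentSeq θ) (hφ : IsFlowOf F φ) {x : ℤ → V}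
    (hx : ∀ i, θ i ∈ D → D ⊆ Ici (θ i) ∨
      x i = φ (θ i - θ (i - 1)) (x (i - 1) + G (x (i - 1)))) :
    IsImpulsiveSolution F G θ D (glueFlow θ G φ x) where
  ode t _ hr := by
    have ht : t ∈ Ioo (θ (momentIndex θ t - 1)) (θ (momentIndex θ t)) :=
      ⟨hθ.moment_index_sub_one_lt t, hθ.lt_moment_index hr⟩
    rw [glueFlow_of_mem_Ioo hθ x ht]
    refine ((hφ.hasDerivAt_sub _ _ t).congr_of_eventuallyEq ?_).hasDerivWithinAt
    filter_upwards [Ioo_mem_nhds ht.1 ht.2] with r hr using glueFlow_of_mem_Ioo hθ x hr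
  ode_left i hi := by
    rcases hx i hi with h | h
    · refine HasDerivWithinAt.mono (t := {θ i}) ?_ fun r hr => le_antisymm hr.2 (h hr.1)
      simp [hasDerivWithinAt_iff_tendsto_slope]
    · rw [glueFlow_moment hθ]
      have h1 := hφ.hasDerivAt_sub (x (i - 1) + G (x (i - 1))) (θ (i - 1)) (θ i)
      rw [← h] at h1
      refine h1.hasDerivWithinAt.congr_of_eventuallyEq (nhdsWithin_mono _ inter_subset_right ?_)
        ((glueFlow_moment hθ x i).trans h)
      filter_upwards [Ioc_mem_nhdsLE (hθ.strictMono (sub_one_lt i))] with r hr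
      rcases hr.2.lt_or_eq with h2 | rfl
      · exact glueFlow_of_mem_Ioo hθ x ⟨hr.1, h2⟩
      · exact (glueFlow_moment hθ x i).trans h
  jump i _ := by
    rw [glueFlow_moment hθ]
    have h1 : Tendsto (fun r => φ (r - θ i) (x i + G (x i))) (𝓝[>] (θ i)) (𝓝 (x i + G (x i))) := by
      have h2 := ((hφ.hasDerivAt_sub (x i + G (x i)) (θ i) (θ i)).continuousAt.tendsto).mono_left
        (nhdsWithin_le_nhds (s := Ioi (θ i)))
      rwa [sub_self, hφ.zero] at h2
    refine h1.congr' ?_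
    filter_upwards [Ioo_mem_nhdsGT (hθ.strictMono (lt_add_one i))] with r hr
    have h3 := glueFlow_of_mem_Ioo (G := G) (φ := φ) hθ x (i := i + 1) (t := r) (by simpa using hr)
    rw [h3]; simp

/-- Forward existence. -/
lemma exists_solution_Ici (hθ : IsMomentSeq θ) (hφ : IsFlowOf F φ) (j : ℤ) (x₀ : V) :
    ∃ y, IsImpulsiveSolution F G θ (Ici (θ j)) y ∧ y (θ j) = x₀ := by
  set u : ℕ → V := fun n => Nat.rec x₀
    (fun k w => φ (θ (j + k + 1) - θ (j + k)) (w + G w)) n with hu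
  refine ⟨glueFlow θ G φ fun i => u (i - j).toNat, isImpulsiveSolution_glueFlow hθ hφ ?_, ?_⟩
  · intro i hi
    have hji : j ≤ i := hθ.strictMono.le_iff_le.1 hi
    rcases hji.eq_or_lt with rfl | hlt
    · exact Or.inl subset_rfl
    · right
      have h1 : (i - j).toNat = (i - 1 - j).toNat + 1 := by omega
      have h2 : j + ((i - 1 - j).toNat : ℤ) = i - 1 := by omega
      rw [h1]
      simp only [hu, h2, sub_add_cancel]
  · simp [glueFlow_moment hθ, hu]

/-- A solution follows the flow between two consecutive moments. -/
lemma IsImpulsiveSolution.eq_flow (hθ : IsMomentSeq θ) {K : NNReal} (hF : LipschitzWith K F)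
    (hφ : IsFlowOf F φ) (hz : IsImpulsiveSolution F G θ D z) {i : ℤ} {t : ℝ}
    (hD : Icc (θ i) t ⊆ D) (hit : θ i < t) (hti : t ≤ θ (i + 1)) :
    z t = φ (t - θ i) (z (θ i) + G (z (θ i))) := by
  have hno : ∀ r ∈ Ioo (θ i) t, r ∉ range θ := fun r hr =>
    hθ.notMem_range_of_mem_Ioo (i := i + 1) (by simpa using hr.1) (hr.2.trans_le hti)
  have hder : ∀ r ∈ Ioo (θ i) t, HasDerivAt z (F (z r)) r := fun r hr =>
    (hz.ode r (hD (Ioo_subset_Icc_self hr)) (hno r hr)).hasDerivAt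
      (mem_of_superset (Icc_mem_nhds hr.1 hr.2) hD)
  have hleft : ContinuousWithinAt z (Iio t) t := by
    have h1 : Icc (θ i) t ∈ 𝓝[≤] t := Icc_mem_nhdsLE hit
    refine continuousWithinAt_Iio_iff_Iic.2 ?_
    have htD : t ∈ D := hD (right_mem_Icc.2 hit.le)
    by_cases h : t ∈ range θ
    · obtain ⟨k, rfl⟩ := h
      exact (hz.ode_left k htD).continuousWithinAt.mono_of_mem_nhdsWithin
        (mem_of_superset h1 fun r hr => ⟨hD hr, hr.2⟩)
    · exact (hz.ode t htD h).continuousWithinAt.mono_of_mem_nhdsWithin (mem_of_superset h1 hD)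
  -- Uniqueness applies from any interior time `s`; joint continuity of the flow then lets `s`
  -- decrease to `θ i`, where `z` tends to its value after the jump.
  have key : ∀ s ∈ Ioo (θ i) t, z t = φ (t - s) (z s) := by
    intro s hs
    refine ODE_solution_unique (v := fun _ => F) (fun _ => hF)
      (continuousOn_Icc_of_hasDerivAt_Ioo hder hleft hs)
      (fun r hr => (hder r ⟨hs.1.trans_le hr.1, hr.2⟩).hasDerivWithinAt)
      (fun r _ => (hφ.hasDerivAt_sub (z s) s r).continuousAt.continuousWithinAt)
      (fun r _ => (hφ.hasDerivAt_sub (z s) s r).hasDerivWithinAt) ?_ (right_mem_Icc.2 hs.2.le)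
    simp [hφ.zero]
  have h1 : Tendsto (fun s => t - s) (𝓝[>] (θ i)) (𝓝 (t - θ i)) :=
    (Continuous.tendsto (by fun_prop) _).mono_left nhdsWithin_le_nhds
  have h2 := (hφ.continuous.tendsto (t - θ i, z (θ i) + G (z (θ i)))).comp
    (h1.prodMk_nhds (hz.jump i (hD (left_mem_Icc.2 hit.le))))
  refine tendsto_nhds_unique (tendsto_const_nhds.congr' ?_) h2
  filter_upwards [Ioo_mem_nhdsGT hit] with s hs using key s hs

end Gluing

/-! ### Existence, uniqueness and attraction of bounded solutions -/

section Attractor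

variable {V : Type*} [NormedAddCommGroup V] [NormedSpace ℝ V]

/-- The assumptions on the right-hand sides of the impulsive equation. -/
structure IsContractingSystem (a b : V →L[ℝ] V) (f W : V → V) (L N ω M : ℝ) : Prop where
  comm : Commute a b
  N_pos : 0 < N
  ω_pos : 0 < ω
  L_nonneg : 0 ≤ L
  f_lip : ∀ x y, ‖f x - f y‖ ≤ L * ‖x - y‖
  W_lip : ∀ x y, ‖W x - W y‖ ≤ L * ‖x - y‖
  f_le : ∀ x, ‖f x‖ ≤ M
  W_le : ∀ x, ‖W x‖ ≤ M
  rate : -ω + N * L + Real.log (1 + N * L) < 0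

/-- Exponential decay of the transition operators with impulse moments `θ`. -/
structure IsDecaying (a b : V →L[ℝ] V) (N ω : ℝ) (θ : ℤ → ℝ) : Prop extends IsMomentSeq θ where
  norm_le : ∀ s t, s ≤ t → ‖fundamentalMatrix θ a b t s‖ ≤ N * Real.exp (-ω * (t - s))

/-- A bound for the bounded solutions. -/
noncomputable def attractorRadius (N ω M : ℝ) : ℝ :=
  N * (M / ω + M * Real.exp ω / (1 - Real.exp (-ω)))

variable {a b : V →L[ℝ] V} {f W : V → V} {L N ω M : ℝ} {θ : ℤ → ℝ}

namespace IsContractingSystem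

lemma M_nonneg (H : IsContractingSystem a b f W L N ω M) : 0 ≤ M :=
  (norm_nonneg _).trans (H.f_le 0)

lemma radius_nonneg (H : IsContractingSystem a b f W L N ω M) : 0 ≤ attractorRadius N ω M := by
  have h1 := Real.exp_lt_one_iff.2 (neg_lt_zero.2 H.ω_pos)
  have h2 : 0 < 1 - Real.exp (-ω) := by linarith
  have := H.M_nonneg
  have := H.N_pos
  have := H.ω_pos
  unfold attractorRadius
  positivity

lemma f_lipschitz (H : IsContractingSystem a b f W L N ω M) :
    LipschitzWith (Real.toNNReal L) f :=
  LipschitzWith.of_dist_le' fun x y => by simpa [dist_eq_norm] using H.f_lip x y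

lemma field_lipschitz (H : IsContractingSystem a b f W L N ω M) :
    LipschitzWith (‖a‖₊ + Real.toNNReal L) fun x => a x + f x :=
  a.lipschitz.add H.f_lipschitz

lemma W_continuous (H : IsContractingSystem a b f W L N ω M) : Continuous W :=
  (LipschitzWith.of_dist_le' (K := L) fun x y => by
    simpa [dist_eq_norm] using H.W_lip x y).continuous

lemma jump_continuous (H : IsContractingSystem a b f W L N ω M) :
    Continuous fun x => x + (b x + W x) :=
  continuous_id.add (b.continuous.add H.W_continuous)

variable [CompleteSpace V]

lemma exists_flow (H : IsContractingSystem a b f W L N ω M) :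
    ∃ φ : ℝ → V → V, IsFlowOf (fun x => a x + f x) φ :=
  exists_isFlowOf a H.f_lipschitz H.f_le

lemma norm_le (H : IsContractingSystem a b f W L N ω M) (hθ : IsDecaying a b N ω θ) {D : Set ℝ}
    {y : ℝ → V} (hy : IsImpulsiveSolution (fun x => a x + f x) (fun x => b x + W x) θ D y)
    {s τ : ℝ} (hD : Icc s τ ⊆ D) (hst : s ≤ τ) :
    ‖y τ‖ ≤ N * Real.exp (-ω * (τ - s)) * ‖y s‖ + attractorRadius N ω M :=
  (isForcedSolution_of_isImpulsiveSolution hy hD).norm_le_of_bounded hθ.toIsMomentSeq H.comm H.N_pos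
    H.ω_pos hθ.norm_le hst (fun _ => H.f_le _) (fun _ => H.W_le _)

lemma norm_le' (H : IsContractingSystem a b f W L N ω M) (hθ : IsDecaying a b N ω θ) {D : Set ℝ}
    {y : ℝ → V} (hy : IsImpulsiveSolution (fun x => a x + f x) (fun x => b x + W x) θ D y)
    {s τ : ℝ} (hD : Icc s τ ⊆ D) (hst : s ≤ τ) :
    ‖y τ‖ ≤ N * ‖y s‖ + attractorRadius N ω M := by
  refine (H.norm_le hθ hy hD hst).trans ?_
  have h1 : Real.exp (-ω * (τ - s)) ≤ 1 :=
    Real.exp_le_one_iff.2 (by nlinarith [H.ω_pos])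
  have := H.N_pos
  gcongr
  nlinarith

/-- The exponential rate of attraction. -/
lemma norm_sub_le (H : IsContractingSystem a b f W L N ω M) (hθ : IsDecaying a b N ω θ)
    {D : Set ℝ} {y z : ℝ → V}
    (hy : IsImpulsiveSolution (fun x => a x + f x) (fun x => b x + W x) θ D y)
    (hz : IsImpulsiveSolution (fun x => a x + f x) (fun x => b x + W x) θ D z)
    {s τ : ℝ} (hD : Icc s τ ⊆ D) (hst : s ≤ τ) :
    ‖y τ - z τ‖ ≤ N * (1 + N * L) ^ (2 : ℕ) *
      Real.exp (-(-(-ω + N * L + Real.log (1 + N * L))) * (τ - s)) * ‖y s - z s‖ := by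
  have h := (isForcedSolution_of_isImpulsiveSolution hy hD).sub
    (isForcedSolution_of_isImpulsiveSolution hz hD)
  refine h.norm_le_exp hθ.toIsMomentSeq H.comm H.N_pos hθ.norm_le hst H.L_nonneg
    (fun t _ => H.f_lip _ _) (fun i _ => H.W_lip _ _)
    (C := (N * ‖y s‖ + attractorRadius N ω M) + (N * ‖z s‖ + attractorRadius N ω M)) ?_
  intro t ht
  have hDt : Icc s t ⊆ D := (Icc_subset_Icc_right ht.2).trans hD
  exact (_root_.norm_sub_le _ _).trans (add_le_add (H.norm_le' hθ hy hDt ht.1) (H.norm_le' hθ hz hDt ht.1))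

/-- Constants `C, c > 0` for the exponential attraction which depend only on the system. -/
lemma exists_rate (H : IsContractingSystem a b f W L N ω M) : ∃ C c : ℝ, 0 < C ∧ 0 < c ∧
    ∀ {θ : ℤ → ℝ}, IsDecaying a b N ω θ → ∀ {D : Set ℝ} {y z : ℝ → V},
    IsImpulsiveSolution (fun x => a x + f x) (fun x => b x + W x) θ D y →
    IsImpulsiveSolution (fun x => a x + f x) (fun x => b x + W x) θ D z →
    ∀ {s τ : ℝ}, Icc s τ ⊆ D → s ≤ τ → ‖y τ - z τ‖ ≤ C * Real.exp (-c * (τ - s)) * ‖y s - z s‖ := by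
  have h1 := mul_nonneg H.N_pos.le H.L_nonneg
  exact ⟨N * (1 + N * L) ^ (2 : ℕ), -(-ω + N * L + Real.log (1 + N * L)),
    mul_pos H.N_pos (by positivity), by linarith [H.rate], fun hθ _ _ _ hy hz _ _ hD hst =>
    H.norm_sub_le hθ hy hz hD hst⟩

/-- Bounded solutions lie in the ball of radius `attractorRadius`. -/
lemma norm_le_radius (H : IsContractingSystem a b f W L N ω M) (hθ : IsDecaying a b N ω θ)
    {z : ℝ → V} (hz : IsImpulsiveSolution (fun x => a x + f x) (fun x => b x + W x) θ univ z)
    {K : ℝ} (hK : ∀ t, ‖z t‖ ≤ K) (t : ℝ) : ‖z t‖ ≤ attractorRadius N ω M := by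
  -- The initial time `t - r` is sent to `-∞`, which kills the contribution of the initial value.
  have h1 : Tendsto (fun r : ℝ => N * Real.exp (-ω * r) * K + attractorRadius N ω M) atTop
      (𝓝 (N * 0 * K + attractorRadius N ω M)) := by
    refine (((Real.tendsto_exp_atBot.comp ?_).const_mul N).mul_const K).add_const _
    exact tendsto_id.const_mul_atTop_of_neg (neg_lt_zero.2 H.ω_pos)
  rw [mul_zero, zero_mul, zero_add] at h1
  refine ge_of_tendsto h1 ?_
  filter_upwards [eventually_ge_atTop 0] with r hr
  have h2 := H.norm_le hθ hz (s := t - r) (τ := t) (subset_univ _) (by linarith)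
  rw [sub_sub_cancel] at h2
  have := H.N_pos
  have h3 := hK (t - r)
  refine h2.trans ?_
  gcongr

lemma tendsto_mul_exp {c : ℝ} (hc : 0 < c) (C K : ℝ) :
    Tendsto (fun r : ℝ => C * Real.exp (-c * r) * K) atTop (𝓝 0) := by
  have h1 : Tendsto (fun r : ℝ => C * Real.exp (-c * r) * K) atTop (𝓝 (C * 0 * K)) := by
    refine ((Real.tendsto_exp_atBot.comp ?_).const_mul C).mul_const K
    exact tendsto_id.const_mul_atTop_of_neg (neg_lt_zero.2 hc)
  simpa using h1

/-- The distance at time `t - r` stays bounded while the contraction factor over the length `r`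
tends to `0`. -/
lemma bounded_unique (H : IsContractingSystem a b f W L N ω M) (hθ : IsDecaying a b N ω θ)
    {y z : ℝ → V} (hy : IsImpulsiveSolution (fun x => a x + f x) (fun x => b x + W x) θ univ y)
    (hz : IsImpulsiveSolution (fun x => a x + f x) (fun x => b x + W x) θ univ z)
    {K K' : ℝ} (hK : ∀ t, ‖y t‖ ≤ K) (hK' : ∀ t, ‖z t‖ ≤ K') : y = z := by
  obtain ⟨C, c, hC, hc, h⟩ := H.exists_rate
  funext t
  have h1 := tendsto_mul_exp hc C (K + K')
  have h2 : ‖y t - z t‖ ≤ 0 := by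
    refine ge_of_tendsto h1 ?_
    filter_upwards [eventually_ge_atTop 0] with r hr
    have h2 := h hθ hy hz (s := t - r) (τ := t) (subset_univ _) (by linarith)
    rw [sub_sub_cancel] at h2
    refine h2.trans ?_
    have h3 := (_root_.norm_sub_le (y (t - r)) (z (t - r))).trans (add_le_add (hK _) (hK' _))
    gcongr
  exact sub_eq_zero.1 (norm_le_zero_iff.1 h2)

/-- Pullback limit: the solutions `Y m` started from `0` at the moment of index `-m` stay in a
common ball at the moments, and contraction makes their states at each fixed moment a Cauchy
sequence. The limits satisfy the recursion by continuity of flow and jump, so they glue to a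
solution on the line. -/
lemma exists_bounded (H : IsContractingSystem a b f W L N ω M) (hθ : IsDecaying a b N ω θ) :
    ∃ z, IsImpulsiveSolution (fun x => a x + f x) (fun x => b x + W x) θ univ z ∧
      ∃ K, ∀ t, ‖z t‖ ≤ K := by
  obtain ⟨φ, hφ⟩ := H.exists_flow
  obtain ⟨C, c, hC, hc, hrate⟩ := H.exists_rate
  have hm := hθ.toIsMomentSeq
  set R := attractorRadius N ω M with hR
  have hR0 : 0 ≤ R := H.radius_nonneg
  choose Y hY hY0 using fun m : ℕ =>
    exists_solution_Ici (G := fun x => b x + W x) hm hφ (-(m : ℤ)) 0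
  have hYR : ∀ (m : ℕ) (i : ℤ), -(m : ℤ) ≤ i → ‖Y m (θ i)‖ ≤ R := by
    intro m i hi
    have := H.norm_le' hθ (hY m) Icc_subset_Ici_self (hm.strictMono.monotone hi)
    simpa [hY0] using this
  have hdist : ∀ (i : ℤ) (n m : ℕ), -(n : ℤ) ≤ i → n ≤ m →
      ‖Y m (θ i) - Y n (θ i)‖ ≤ C * Real.exp (-c * (i + n - 1)) * R := by
    intro i n m hi hnm
    have hle : θ (-(m : ℤ)) ≤ θ (-(n : ℤ)) := hm.strictMono.monotone (by omega)
    have h1 := hrate hθ ((hY m).mono (Ici_subset_Ici.2 hle)) (hY n) Icc_subset_Ici_self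
      (hm.strictMono.monotone hi)
    rw [hY0, sub_zero] at h1
    have h2 := hYR m (-(n : ℤ)) (by omega)
    have h3 : Real.exp (-c * (θ i - θ (-(n : ℤ)))) ≤ Real.exp (-c * (i + n - 1)) := by
      have h4 := hm.le_moment i
      have h5 := hm.moment_le (-(n : ℤ))
      push_cast at h5
      exact Real.exp_le_exp.2 (by nlinarith)
    refine h1.trans ?_
    gcongr
  have hlim : ∀ i : ℤ, ∃ x, Tendsto (fun m => Y m (θ i)) atTop (𝓝 x) := by
    intro i
    -- Shifting by `i.natAbs` ensures that every solution considered has started by the `i`-th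
    -- moment and that `i + i.natAbs ≥ 0`.
    have hcau : CauchySeq fun m => Y (m + i.natAbs) (θ i) := by
      refine cauchySeq_of_le_tendsto_0' (fun n : ℕ => C * Real.exp (-c * (n : ℝ)) * (Real.exp c * R))
        (fun n m hnm => ?_) ((tendsto_mul_exp hc C _).comp tendsto_natCast_atTop_atTop)
      rw [dist_comm, dist_eq_norm]
      refine (hdist i (n + i.natAbs) (m + i.natAbs) (by omega) (by omega)).trans ?_
      have h1 : (0 : ℝ) ≤ i + i.natAbs := by
        have : (0 : ℤ) ≤ i + (i.natAbs : ℤ) := by omega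
        calc (0 : ℝ) ≤ ((i + (i.natAbs : ℤ) : ℤ) : ℝ) := Int.cast_nonneg this
          _ = _ := by rw [Int.cast_add, Int.cast_natCast]
      have h2 : Real.exp (-c * (i + (n + i.natAbs : ℕ) - 1)) ≤
          Real.exp (-c * n) * Real.exp c := by
        rw [← Real.exp_add]
        refine Real.exp_le_exp.2 ?_
        push_cast
        nlinarith
      calc _ ≤ C * (Real.exp (-c * n) * Real.exp c) * R := by gcongr
        _ = _ := by ring
    obtain ⟨x, hx⟩ := cauchySeq_tendsto_of_complete hcau
    exact ⟨x, (tendsto_add_atTop_iff_nat i.natAbs).1 hx⟩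
  choose x hx using hlim
  have hxR : ∀ i, ‖x i‖ ≤ R := fun i => by
    refine le_of_tendsto (hx i).norm ?_
    filter_upwards [eventually_ge_atTop i.natAbs] with m hm
    exact hYR m i (by omega)
  have hrec : ∀ i, x i = φ (θ i - θ (i - 1)) (x (i - 1) + (b (x (i - 1)) + W (x (i - 1)))) := by
    intro i
    have hcont : Continuous fun w => φ (θ i - θ (i - 1)) (w + (b w + W w)) :=
      hφ.continuous.comp (continuous_const.prodMk H.jump_continuous)
    refine tendsto_nhds_unique (hx i) (((hcont.tendsto _).comp (hx (i - 1))).congr' ?_)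
    filter_upwards [eventually_ge_atTop (i.natAbs + 1)] with m hm'
    refine ((hY m).eq_flow hm H.field_lipschitz hφ (fun r hr => ?_)
      (hm.strictMono (sub_one_lt i)) (by simp)).symm
    exact (hm.strictMono.monotone (by omega : -(m : ℤ) ≤ i - 1)).trans hr.1
  have hz := isImpulsiveSolution_glueFlow (D := univ) (G := fun x => b x + W x) hm hφ
    (fun i _ => Or.inr (hrec i))
  refine ⟨_, hz, N * R + R, fun t => ?_⟩
  have h1 := H.norm_le' hθ hz (subset_univ _) (hm.moment_index_sub_one_lt t).le
  rw [glueFlow_moment hm] at h1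
  refine h1.trans (add_le_add (mul_le_mul_of_nonneg_left (hxR _) H.N_pos.le) le_rfl)

end IsContractingSystem

end Attractor

/-! ### Symbolic dynamics and orbits -/

section Symbolic

variable {Λ : Set ℝ} {S : Λ ≃ₜ (ℕ → Fin 2)} {h : Λ → Λ}

lemma continuous_of_conj (hconj : ∀ t, S (h t) = fun k => S t (k + 1)) : Continuous h := by
  have h1 : h = fun t => S.symm fun k => S t (k + 1) := by
    funext t
    rw [← hconj, S.symm_apply_apply]
  rw [h1]
  exact S.symm.continuous.comp (continuous_pi fun k => (continuous_apply (k + 1)).comp S.continuous)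

lemma symbol_iterate (hconj : ∀ t, S (h t) = fun k => S t (k + 1)) (t : Λ) (m k : ℕ) :
    S (h^[m] t) k = S t (m + k) := by
  induction m generalizing t with
  | zero => simp
  | succ m ih => rw [Function.iterate_succ_apply, ih, hconj]; exact congrArg (S t) (by omega)

lemma IsOrbit.iterate {κ : ℤ → Λ} (hκ : IsOrbit h κ) (i : ℤ) (m : ℕ) : κ (i + m) = h^[m] (κ i) := by
  induction m with
  | zero => simp
  | succ m ih =>
    rw [Function.iterate_succ_apply', ← ih, ← hκ]
    congr 1
    push_cast; ring

lemma IsOrbit.natCast {κ : ℤ → Λ} (hκ : IsOrbit h κ) (m : ℕ) : κ m = h^[m] (κ 0) := by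
  simpa using hκ.iterate 0 m

lemma IsOrbit.translate {κ : ℤ → Λ} (hκ : IsOrbit h κ) (m : ℤ) : IsOrbit h fun i => κ (i + m) :=
  fun i => by
    change κ (i + 1 + m) = h (κ (i + m))
    rw [← hκ]; congr 1; ring

/-- A two-sided symbol sequence also prescribes the past of an orbit; a periodic one gives a
periodic orbit. -/
lemma isOrbit_symbols (hconj : ∀ t, S (h t) = fun k => S t (k + 1)) (s : ℤ → Fin 2) :
    IsOrbit h fun i => S.symm fun k => s (i + k) := fun i => by
  apply S.injective
  rw [hconj, S.apply_symm_apply, S.apply_symm_apply]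
  funext k
  congr 1
  push_cast; ring

lemma isMomentSeq_moments (hΛ : Λ ⊆ Icc 0 1) (hsep : ∀ t : Λ, (t : ℝ) < 1 + (h t : ℝ))
    {κ : ℤ → Λ} (hκ : IsOrbit h κ) : IsMomentSeq (moments κ) where
  strictMono := strictMono_int_of_lt_succ fun i => by
    have h1 := hsep (κ i)
    rw [← hκ i] at h1
    simp only [moments]
    push_cast
    linarith
  le_moment i := by have := (hΛ (κ i).2).1; simp only [moments]; linarith
  moment_le i := by have := (hΛ (κ i).2).2; simp only [moments]; linarith

/-- Points with the same long initial block of symbols are close. -/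
lemma exists_block_of_mem_nhds {t : Λ} {U : Set Λ} (hU : U ∈ 𝓝 t) :
    ∃ R : ℕ, ∀ t' : Λ, (∀ k < R, S t' k = S t k) → t' ∈ U := by
  obtain ⟨O, hOU, hO, htO⟩ := mem_nhds_iff.1 hU
  obtain ⟨I, u, hu, hsub⟩ := isOpen_pi_iff.1 (hO.preimage S.symm.continuous) (S t) (by simpa using htO)
  refine ⟨I.sup id + 1, fun t' ht' => hOU ?_⟩
  have h1 : S t' ∈ S.symm ⁻¹' O := hsub fun k hk => by
    rw [ht' k (Nat.lt_succ_of_le (Finset.le_sup (f := id) hk))]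
    exact (hu k hk).2
  simpa using h1

/-- A sequence that contains every finite word. -/
lemma exists_universal_sequence :
    ∃ s : ℕ → Fin 2, ∀ (w : ℕ → Fin 2) (R : ℕ), ∃ m, ∀ k < R, s (m + k) = w k := by
  let toBit : Bool → Fin 2 := fun c => if c then 1 else 0
  -- The position `n ^ 2 + j` with `j ≤ 2 n` carries the `j`-th binary digit of `n`, so the block
  -- after `n ^ 2` spells out `n`.
  refine ⟨fun p => toBit ((Nat.sqrt p).testBit (p - Nat.sqrt p ^ 2)), fun w R => ?_⟩
  obtain ⟨n, hn⟩ : ∃ n : ℕ, ∀ k < R, toBit (n.testBit k) = w k := by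
    refine ⟨Nat.ofBits fun k : Fin R => decide (w k = 1), fun k hk => ?_⟩
    rw [Nat.testBit_ofBits_lt _ _ hk]
    have h2 : ∀ c : Fin 2, toBit (decide (c = 1)) = c := by decide
    exact h2 _
  have hR : R < 2 ^ R := Nat.lt_two_pow_self
  -- Adding `2 ^ R` leaves the digits below `R` unchanged and makes the block longer than `R`.
  refine ⟨(2 ^ R + n) ^ 2, fun k hk => ?_⟩
  have h3 : Nat.sqrt ((2 ^ R + n) ^ 2 + k) = 2 ^ R + n := by
    rw [sq]; exact Nat.sqrt_add_eq _ (by omega)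
  simp only [h3, Nat.add_sub_cancel_left]
  rw [← hn k hk, Nat.testBit_two_pow_add_gt hk]

end Symbolic

/-! ### Translation in time -/

section Translation

variable {V : Type*} [NormedAddCommGroup V] [NormedSpace ℝ V] {F G : V → V} {z : ℝ → V}

lemma IsImpulsiveSolution.translate {θ : ℤ → ℝ} (hz : IsImpulsiveSolution F G θ univ z) (m : ℤ)
    (r : ℝ) : IsImpulsiveSolution F G (fun i => θ (i + m) - r) univ fun t => z (t + r) where
  ode t _ ht := by
    have h1 : t + r ∉ range θ := by
      rintro ⟨i, hi⟩
      exact ht ⟨i - m, by simp [hi]⟩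
    have h2 := (hz.ode (t + r) trivial h1).hasDerivAt univ_mem
    exact (h2.comp_add_const t r).hasDerivWithinAt
  ode_left i _ := by
    have h1 := hz.ode_left (i + m) trivial
    simp only [univ_inter, sub_add_cancel] at h1 ⊢
    have h2 : HasDerivWithinAt (fun t : ℝ => t + r) 1 (Iic (θ (i + m) - r)) (θ (i + m) - r) :=
      ((hasDerivAt_id _).add_const r).hasDerivWithinAt
    have h3 : HasDerivWithinAt z (F (z (θ (i + m)))) (Iic (θ (i + m))) (θ (i + m) - r + r) := by
      rwa [sub_add_cancel]
    have := h3.scomp (θ (i + m) - r) h2 fun t (ht : t ≤ _) => by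
      change t + r ≤ _; linarith
    simpa [Function.comp_def] using this
  jump i _ := by
    have h1 := hz.jump (i + m) trivial
    simp only [sub_add_cancel]
    refine h1.comp (tendsto_nhdsWithin_iff.2 ⟨?_, ?_⟩)
    · have h2 : Continuous fun t : ℝ => t + r := by fun_prop
      simpa using (h2.tendsto (θ (i + m) - r)).mono_left (nhdsWithin_le_nhds (s := Ioi _))
    · filter_upwards [self_mem_nhdsWithin] with t ht
      exact sub_lt_iff_lt_add.1 (mem_Ioi.1 ht)

lemma moments_translate {Λ : Set ℝ} (κ : ℤ → Λ) (m : ℤ) :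
    moments (fun i => κ (i + m)) = fun i => moments κ (i + m) - m := by
  funext i
  simp only [moments]
  push_cast; ring

end Translation

/-- A point that is not a moment has a positive distance to the moments. -/
lemma IsMomentSeq.exists_margin {θ : ℤ → ℝ} (hθ : IsMomentSeq θ) {r : ℝ} (hr : r ∉ range θ) :
    ∃ ρ > 0, ∀ i, ρ ≤ |r - θ i| := by
  have h1 := hθ.moment_index_sub_one_lt r
  have h2 := hθ.lt_moment_index hr
  refine ⟨min (r - θ (momentIndex θ r - 1)) (θ (momentIndex θ r) - r),
    lt_min (by linarith) (by linarith), fun i => ?_⟩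
  rcases lt_or_ge i (momentIndex θ r) with hi | hi
  · have := hθ.strictMono.monotone (by omega : i ≤ momentIndex θ r - 1)
    exact (min_le_left _ _).trans (le_trans (by linarith) (le_abs_self _))
  · have := hθ.strictMono.monotone hi
    exact (min_le_right _ _).trans (le_trans (by linarith) (neg_le_abs _))

/-! ### Continuous dependence on the starting point -/

section Matching

variable {V : Type*} [NormedAddCommGroup V] [NormedSpace ℝ V]

/-- The state at the `i`-th moment of the solution that starts at `0` at the `0`-th moment `t`. -/
noncomputable def stateAt {Λ : Set ℝ} (h : Λ → Λ) (G : V → V) (φ : ℝ → V → V) (t : Λ) : ℕ → V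
  | 0 => 0
  | i + 1 => φ (1 + (h^[i + 1] t : ℝ) - (h^[i] t : ℝ))
      (stateAt h G φ t i + G (stateAt h G φ t i))

variable {a b : V →L[ℝ] V} {f W : V → V} {L N ω M : ℝ} {Λ : Set ℝ} {h : Λ → Λ} {φ : ℝ → V → V}

/-- Starting from `0` removes the past: the state is a finite composition of jumps and flows whose
durations are continuous in `t`. -/
lemma IsContractingSystem.continuous_stateAt (H : IsContractingSystem a b f W L N ω M)
    (hφ : IsFlowOf (fun x => a x + f x) φ) (hh : Continuous h) (i : ℕ) :
    Continuous fun t => stateAt h (fun x => b x + W x) φ t i := by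
  induction i with
  | zero => exact continuous_const
  | succ i ih =>
    have h1 : ∀ j, Continuous fun t : Λ => (h^[j] t : ℝ) := fun j =>
      continuous_subtype_val.comp (hh.iterate j)
    exact hφ.continuous.comp (((continuous_const.add (h1 (i + 1))).sub (h1 i)).prodMk
      (H.jump_continuous.comp ih))

/-- Bounded solutions forget their past exponentially. -/
lemma IsContractingSystem.exists_forget [CompleteSpace V] (H : IsContractingSystem a b f W L N ω M)
    (hφ : IsFlowOf (fun x => a x + f x) φ)
    (hdec : ∀ κ : ℤ → Λ, IsOrbit h κ → IsDecaying a b N ω (moments κ)) :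
    ∃ C c : ℝ, 0 < c ∧ ∀ κ : ℤ → Λ, IsOrbit h κ → ∀ z K,
      IsImpulsiveSolution (fun x => a x + f x) (fun x => b x + W x) (moments κ) univ z →
      (∀ t, ‖z t‖ ≤ K) → ∀ i : ℕ,
      ‖z (moments κ i) - stateAt h (fun x => b x + W x) φ (κ 0) i‖ ≤
        C * Real.exp (-c * i) * attractorRadius N ω M := by
  obtain ⟨C, c, hC, hc, hrate⟩ := H.exists_rate
  refine ⟨C * Real.exp c, c, hc, fun κ hκ z K hz hK i => ?_⟩
  have hd := hdec κ hκ
  -- The comparison solution `y` starts from `0` at the `0`-th moment and its states are exactly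
  -- `stateAt`.
  obtain ⟨y, hy, hy0⟩ := exists_solution_Ici (G := fun x => b x + W x) hd.toIsMomentSeq hφ 0 0
  have hyi : ∀ i : ℕ, y (moments κ i) = stateAt h (fun x => b x + W x) φ (κ 0) i := by
    intro i
    induction i with
    | zero => simpa [stateAt] using hy0
    | succ i ih =>
      have h1 := hy.eq_flow hd.toIsMomentSeq H.field_lipschitz hφ (i := i) (t := moments κ (i + 1))
        (fun r hr => (hd.strictMono.monotone (by omega : (0 : ℤ) ≤ i)).trans hr.1)
        (hd.strictMono (lt_add_one _)) le_rfl
      rw [ih] at h1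
      rw [Nat.cast_succ, h1, stateAt, ← hκ.natCast, ← hκ.natCast]
      congr 1
      simp only [moments]
      push_cast; ring
  have h0i : moments κ 0 ≤ moments κ i := hd.strictMono.monotone (by omega : (0 : ℤ) ≤ i)
  have h1 := hrate hd (hz.mono (subset_univ _)) hy
    (show Icc (moments κ 0) (moments κ i) ⊆ Ici (moments κ 0) from Icc_subset_Ici_self) h0i
  rw [hy0, sub_zero, hyi] at h1
  refine h1.trans ?_
  have h2 := H.norm_le_radius hd hz hK (moments κ 0)
  have h3 : Real.exp (-c * (moments κ i - moments κ 0)) ≤ Real.exp c * Real.exp (-c * i) := by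
    rw [← Real.exp_add]
    have h4 := hd.le_moment i
    have h5 := hd.moment_le 0
    push_cast at h4 h5
    exact Real.exp_le_exp.2 (by nlinarith)
  calc _ ≤ C * (Real.exp c * Real.exp (-c * i)) * attractorRadius N ω M := by gcongr
    _ = _ := by ring

/-- Bounded solutions depend continuously on the start of the sequence of moments, with respect to
`ε`-equivalence on a suitable interval. -/
lemma IsContractingSystem.exists_eventually_epsEquivalent [ProperSpace V] [CompleteSpace V]
    (H : IsContractingSystem a b f W L N ω M)
    (hh : Continuous h)
    (hdec : ∀ κ : ℤ → Λ, IsOrbit h κ → IsDecaying a b N ω (moments κ))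
    {κ₁ : ℤ → Λ} (hκ₁ : IsOrbit h κ₁) {z₁ : ℝ → V} {K₁ : ℝ}
    (hz₁ : IsImpulsiveSolution (fun x => a x + f x) (fun x => b x + W x) (moments κ₁) univ z₁)
    (hK₁ : ∀ t, ‖z₁ t‖ ≤ K₁) {ε E : ℝ} (hε : 0 < ε) :
    ∃ r : ℝ, ∀ᶠ t in 𝓝 (κ₁ 0), ∀ κ : ℤ → Λ, IsOrbit h κ → κ 0 = t → ∀ z K,
      IsImpulsiveSolution (fun x => a x + f x) (fun x => b x + W x) (moments κ) univ z →
      (∀ t, ‖z t‖ ≤ K) → EpsEquivalent ε (Ioo r (r + E)) (moments κ) z (moments κ₁) z₁ := by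
  obtain ⟨φ, hφ⟩ := H.exists_flow
  obtain ⟨C, c, hc, hforget⟩ := H.exists_forget hφ hdec
  set R := attractorRadius N ω M
  have hd₁ := hdec κ₁ hκ₁
  have hm₁ := hd₁.toIsMomentSeq
  -- uniform continuity of the flow on the relevant compact set
  obtain ⟨δ, hδ, hunif⟩ : ∃ δ > 0, ∀ t ∈ Icc (0 : ℝ) 2, ∀ t' ∈ Icc (0 : ℝ) 2,
      ∀ x ∈ Metric.closedBall (0 : V) R, ∀ x' ∈ Metric.closedBall (0 : V) R,
      |t - t'| < δ → ‖x - x'‖ < δ → ‖φ t (x + (b x + W x)) - φ t' (x' + (b x' + W x'))‖ < ε := by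
    have h1 : Continuous fun p : ℝ × V => φ p.1 (p.2 + (b p.2 + W p.2)) :=
      hφ.continuous.comp (continuous_fst.prodMk (H.jump_continuous.comp continuous_snd))
    have h2 := (isCompact_Icc (a := (0 : ℝ)) (b := 2)).prod
      (isCompact_closedBall (0 : V) R) |>.uniformContinuousOn_of_continuous h1.continuousOn
    obtain ⟨δ, hδ, h3⟩ := Metric.uniformContinuousOn_iff.1 h2 ε hε
    refine ⟨δ, hδ, fun t ht t' ht' x hx x' hx' h4 h5 => ?_⟩
    have := h3 (t, x) ⟨ht, hx⟩ (t', x') ⟨ht', hx'⟩ (by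
      rw [Prod.dist_eq, max_lt_iff, Real.dist_eq, dist_eq_norm]; exact ⟨h4, h5⟩)
    rwa [dist_eq_norm] at this
  -- a time after which the past is forgotten
  obtain ⟨T, hT⟩ : ∃ T : ℕ, ∀ i : ℕ, T ≤ i → C * Real.exp (-c * i) * R < δ / 3 := by
    have h1 := (IsContractingSystem.tendsto_mul_exp hc C R).comp
      (tendsto_natCast_atTop_atTop (R := ℝ))
    exact eventually_atTop.1 (h1.eventually_lt_const (by positivity : 0 < δ / 3))
  -- an interval whose end points are not moments
  obtain ⟨r, hrI, hr⟩ : ∃ r ∈ Ioo ((T : ℝ) + 2) (T + 3),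
      r ∉ range (moments κ₁) ∧ r + E ∉ range (moments κ₁) := by
    have h1 : (range (moments κ₁) ∪ range fun i => moments κ₁ i - E).Countable :=
      (countable_range _).union (countable_range _)
    obtain ⟨r, hr, hrI⟩ := (h1.dense_compl ℝ).exists_mem_open isOpen_Ioo
      (nonempty_Ioo.2 (by linarith : (T : ℝ) + 2 < T + 3))
    refine ⟨r, hrI, fun h2 => hr (Or.inl h2), ?_⟩
    rintro ⟨i, hi⟩
    exact hr (Or.inr ⟨i, by simp [hi]⟩)
  obtain ⟨ρ₁, hρ₁, hmargin₁⟩ := hm₁.exists_margin hr.1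
  obtain ⟨ρ₂, hρ₂, hmargin₂⟩ := hm₁.exists_margin hr.2
  -- Since `r < T + 3`, only indices up to `Q` matter on the interval, so finitely many continuity
  -- conditions suffice.
  set Q : ℕ := ⌈(T : ℝ) + 5 + E⌉₊
  have hQ : (T : ℝ) + 5 + E ≤ Q := Nat.le_ceil _
  refine ⟨r, ?_⟩
  have hev : ∀ i : ℕ, ∀ᶠ t in 𝓝 (κ₁ 0),
      |(h^[i] t : ℝ) - h^[i] (κ₁ 0)| < min (min ρ₁ ρ₂) (min (ε / 2) (δ / 2)) ∧
      ‖stateAt h (fun x => b x + W x) φ t i - stateAt h (fun x => b x + W x) φ (κ₁ 0) i‖ <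
        δ / 3 := by
    intro i
    have h1 : Continuous fun t : Λ => (h^[i] t : ℝ) := continuous_subtype_val.comp (hh.iterate i)
    have h2 := (Metric.tendsto_nhds.1 (h1.tendsto (κ₁ 0)))
      (min (min ρ₁ ρ₂) (min (ε / 2) (δ / 2))) (by positivity)
    have h3 := (Metric.tendsto_nhds.1 ((H.continuous_stateAt hφ hh i).tendsto (κ₁ 0)))
      (δ / 3) (by positivity)
    filter_upwards [h2, h3] with t h4 h5
    exact ⟨by rwa [Real.dist_eq] at h4, by rwa [dist_eq_norm] at h5⟩
  filter_upwards [(Finset.range (Q + 1)).eventually_all.2 fun i _ => hev i] with t ht κ hκ hκt z K hz hK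
  have hd := hdec κ hκ
  have hm := hd.toIsMomentSeq
  -- closeness of the moments and of the states
  have hclose : ∀ i : ℤ, 0 ≤ i → (i : ℝ) ≤ T + 5 + E →
      |moments κ i - moments κ₁ i| < min (min ρ₁ ρ₂) (min (ε / 2) (δ / 2)) := by
    intro i hi hiQ
    lift i to ℕ using hi
    have h1 : i ≤ Q := by
      have : (i : ℝ) ≤ Q := le_trans (by exact_mod_cast hiQ) hQ
      exact_mod_cast this
    have h2 := (ht i (Finset.mem_range.2 (by omega))).1
    rw [← hκt, ← hκ.natCast, ← hκ₁.natCast] at h2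
    simpa [moments] using h2
  have hstate : ∀ i : ℤ, (T : ℤ) ≤ i → (i : ℝ) ≤ T + 5 + E →
      ‖z (moments κ i) - z₁ (moments κ₁ i)‖ < δ := by
    intro i hi hiQ
    lift i to ℕ using (by omega)
    have h1 : i ≤ Q := by
      have : (i : ℝ) ≤ Q := le_trans (by exact_mod_cast hiQ) hQ
      exact_mod_cast this
    have h2 := (ht i (Finset.mem_range.2 (by omega))).2
    rw [← hκt] at h2
    have h3 := hforget κ hκ z K hz hK i
    have h4 := hforget κ₁ hκ₁ z₁ K₁ hz₁ hK₁ i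
    have h5 := hT i (by omega)
    set p := stateAt h (fun x => b x + W x) φ (κ 0) i
    set p₁ := stateAt h (fun x => b x + W x) φ (κ₁ 0) i
    calc ‖z (moments κ i) - z₁ (moments κ₁ i)‖
        = ‖(z (moments κ i) - p) + (p - p₁) + (p₁ - z₁ (moments κ₁ i))‖ := by congr 1; abel
      _ ≤ ‖z (moments κ i) - p‖ + ‖p - p₁‖ + ‖p₁ - z₁ (moments κ₁ i)‖ := norm_add₃_le
      _ < δ := by rw [norm_sub_rev p₁]; linarith
  refine ⟨fun t ht => ⟨?_, ?_⟩, ?_, ?_⟩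
  · have := hm.moment_le 0
    push_cast at this
    exact le_trans (by linarith [hrI.1, (Nat.cast_nonneg T : (0 : ℝ) ≤ T)]) ht.1.le
  · have := hm₁.moment_le 0
    push_cast at this
    exact le_trans (by linarith [hrI.1, (Nat.cast_nonneg T : (0 : ℝ) ≤ T)]) ht.1.le
  · refine lt_of_le_of_lt (iSup₂_le fun i hi => ?_)
      ((ENNReal.ofReal_lt_ofReal_iff hε).2 (half_lt_self hε))
    have h1 := hm.moment_le i
    have h2 := hm.le_moment i
    have h3 : (0 : ℝ) ≤ i := by
      linarith [hi.1.1, hrI.1, (Nat.cast_nonneg T : (0 : ℝ) ≤ T)]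
    have h4 := hclose i (by exact_mod_cast h3) (by linarith [hi.1.2, hrI.2])
    rw [edist_dist, Real.dist_eq]
    exact ENNReal.ofReal_le_ofReal (h4.le.trans ((min_le_right _ _).trans (min_le_left _ _)))
  · intro t ht hnot
    set i := momentIndex (moments κ₁) t - 1 with hi
    have hit : moments κ₁ i < t := hm₁.moment_index_sub_one_lt t
    have hti : t ≤ moments κ₁ (i + 1) := by
      have := hm₁.le_moment_index t
      rwa [hi, sub_add_cancel]
    have h1 := hm₁.le_moment i
    have h2 := hm₁.moment_le (i + 1)
    push_cast at h2
    have hTi : (T : ℤ) ≤ i := by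
      have : ((T : ℤ) : ℝ) < ((i : ℤ) : ℝ) + 1 := by push_cast; linarith [ht.1, hrI.1]
      have : (T : ℤ) < i + 1 := by exact_mod_cast this
      omega
    have hiQ : (i : ℝ) + 1 ≤ T + 5 + E := by linarith [ht.2, hrI.2]
    have hci := hclose i (by omega) (by linarith)
    have hci1 := hclose (i + 1) (by omega) (by push_cast; linarith)
    -- If both `j`-th moments lie in the interval, `t` is in an exempted gap. Otherwise an end point
    -- of the interval lies between them, and `moments κ₁ j` would be closer to it than the margin
    -- allows.
    have hexcl : ∀ j, t ∈ uIcc (moments κ j) (moments κ₁ j) →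
        |moments κ j - moments κ₁ j| < min (min ρ₁ ρ₂) (min (ε / 2) (δ / 2)) → False := by
      intro j htj hj
      have hj1 := hj.trans_le ((min_le_left _ _).trans (min_le_left _ _))
      have hj2 := hj.trans_le ((min_le_left _ _).trans (min_le_right _ _))
      have hm1 := hmargin₁ j
      have hm2 := hmargin₂ j
      by_cases hJ : moments κ j ∈ Ioo r (r + E) ∧ moments κ₁ j ∈ Ioo r (r + E)
      · exact hnot (mem_iUnion₂.2 ⟨j, hJ, htj⟩)
      · have ht1 := ht.1
        have ht2 := ht.2
        simp only [mem_Ioo, not_and_or, not_lt] at hJ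
        rw [mem_uIcc] at htj
        rw [abs_lt] at hj1 hj2
        rcases abs_cases (r - moments κ₁ j) with ⟨e1, _⟩ | ⟨e1, _⟩ <;>
        rcases abs_cases (r + E - moments κ₁ j) with ⟨e2, _⟩ | ⟨e2, _⟩ <;>
        rcases htj with ⟨g1, g2⟩ | ⟨g1, g2⟩ <;>
        rcases hJ with (hJ | hJ) | (hJ | hJ) <;> linarith
    have hit' : moments κ i < t := by
      by_contra! hlt
      exact hexcl i (mem_uIcc.2 (Or.inr ⟨hit.le, hlt⟩)) hci
    have hti' : t ≤ moments κ (i + 1) := by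
      by_contra! hlt
      exact hexcl (i + 1) (mem_uIcc.2 (Or.inl ⟨hlt.le, hti⟩)) hci1
    -- Now `t` lies between moments of equal indices for both solutions, so both follow the flow
    -- from close states, for close durations not exceeding `2`.
    rw [hz.eq_flow hm H.field_lipschitz hφ (subset_univ _) hit' hti',
      hz₁.eq_flow hm₁ H.field_lipschitz hφ (subset_univ _) hit hti]
    have h3 := hm.le_moment i
    have h4 := hm.moment_le (i + 1)
    push_cast at h4
    refine hunif _ ⟨by linarith, by linarith⟩ _ ⟨by linarith, by linarith⟩ _
      (mem_closedBall_zero_iff.2 (H.norm_le_radius hd hz hK _)) _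
      (mem_closedBall_zero_iff.2 (H.norm_le_radius hd₁ hz₁ hK₁ _)) ?_
      (hstate i hTi (by linarith))
    have h5 := hci.trans_le ((min_le_right _ _).trans (min_le_right _ _))
    rw [sub_sub_sub_cancel_left, abs_sub_comm]
    linarith

end Matching

/-! ### Separation of moments -/

section Separation

variable {Λ : Set ℝ} {S : Λ ≃ₜ (ℕ → Fin 2)} {h : Λ → Λ}

/-- Arbitrarily close to each point there is a point whose orbit has at some time a definite distance
to the orbit of the first one, such that also the next moments are separated from the present ones. -/
lemma exists_separation (hΛ : Λ ⊆ Icc 0 1) (S : Λ ≃ₜ (ℕ → Fin 2))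
    (hconj : ∀ t, S (h t) = fun k => S t (k + 1)) (hsep : ∀ t : Λ, (t : ℝ) < 1 + (h t : ℝ)) :
    ∃ γ > (0 : ℝ), ∀ t : Λ, ∀ δ > (0 : ℝ), ∃ t' : Λ, |(t : ℝ) - t'| < δ ∧ ∃ m : ℕ, 1 ≤ m ∧
      γ ≤ |(h^[m] t : ℝ) - h^[m] t'| ∧
      γ ≤ 1 + min (h^[m + 1] t : ℝ) (h^[m + 1] t') - max (h^[m] t : ℝ) (h^[m] t') := by
  have hh := continuous_of_conj hconj
  have hcompact : CompactSpace Λ := S.symm.compactSpace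
  -- Leading symbol `c₁` rules out the point `0`, and symbol `c₂` in position `2` rules out the
  -- point `1`. Different positions are used so that both can be imposed along one orbit.
  obtain ⟨c₁, hc₁⟩ : ∃ c : Fin 2, ∀ x : Λ, (x : ℝ) = 0 → S x 0 ≠ c := by
    by_cases h0 : (0 : ℝ) ∈ Λ
    · obtain ⟨c, hc⟩ : ∃ c : Fin 2, S ⟨0, h0⟩ 0 ≠ c := ⟨S ⟨0, h0⟩ 0 + 1, by
        generalize S ⟨0, h0⟩ 0 = e; revert e; decide⟩
      exact ⟨c, fun x hx => by rwa [show x = ⟨0, h0⟩ from Subtype.ext hx]⟩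
    · exact ⟨0, fun x hx => absurd (hx ▸ x.2) h0⟩
  obtain ⟨c₂, hc₂⟩ : ∃ c : Fin 2, ∀ x : Λ, (x : ℝ) = 1 → S x 2 ≠ c := by
    by_cases h1 : (1 : ℝ) ∈ Λ
    · obtain ⟨c, hc⟩ : ∃ c : Fin 2, S ⟨1, h1⟩ 2 ≠ c := ⟨S ⟨1, h1⟩ 2 + 1, by
        generalize S ⟨1, h1⟩ 2 = e; revert e; decide⟩
      exact ⟨c, fun x hx => by rwa [show x = ⟨1, h1⟩ from Subtype.ext hx]⟩
    · exact ⟨0, fun x hx => absurd (hx ▸ x.2) h1⟩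
  -- On `P` the two points differ, `h p.2` is not `0` and `p.2` is not `1`. Both gaps are therefore
  -- positive on `P`, and compactness makes them uniform.
  set P : Set (Λ × Λ) := {p | S p.2 0 ≠ S p.1 0 ∧ S p.2 1 = c₁ ∧ S p.2 2 = c₂} with hP
  have hcoord : ∀ k, Continuous fun x : Λ => S x k := fun k => (continuous_apply k).comp S.continuous
  have hPc : IsCompact P := by
    refine IsClosed.isCompact ?_
    have e1 : IsClosed {p : Λ × Λ | S p.2 0 ≠ S p.1 0} :=
      (isClosed_discrete {q : Fin 2 × Fin 2 | q.1 ≠ q.2}).preimage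
        (((hcoord 0).comp continuous_snd).prodMk ((hcoord 0).comp continuous_fst))
    have e2 : IsClosed {p : Λ × Λ | S p.2 1 = c₁} :=
      isClosed_eq ((hcoord 1).comp continuous_snd) continuous_const
    have e3 : IsClosed {p : Λ × Λ | S p.2 2 = c₂} :=
      isClosed_eq ((hcoord 2).comp continuous_snd) continuous_const
    exact e1.inter (e2.inter e3)
  obtain ⟨γ₁, hγ₁, hP₁⟩ := hPc.exists_forall_le' (f := fun p => |(p.1 : ℝ) - p.2|) (a := 0)
    (by fun_prop) (fun p hp => abs_pos.2 (sub_ne_zero.2 fun e => hp.1 (by rw [Subtype.ext e])))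
  have hhv : Continuous fun x : Λ => (h x : ℝ) := continuous_subtype_val.comp hh
  obtain ⟨γ₂, hγ₂, hP₂⟩ := hPc.exists_forall_le'
    (f := fun p => 1 + min (h p.1 : ℝ) (h p.2) - max (p.1 : ℝ) p.2) (a := 0)
    (((continuous_const.add ((hhv.comp continuous_fst).min (hhv.comp continuous_snd))).sub
      ((continuous_subtype_val.comp continuous_fst).max
        (continuous_subtype_val.comp continuous_snd))).continuousOn) (by
      rintro ⟨x, x'⟩ ⟨_, hx1, hx2⟩
      have i1 := hsep x
      have i2 := hsep x'
      have j1 := hΛ x.2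
      have j2 := hΛ x'.2
      have k1 := hΛ (h x).2
      have k2 := hΛ (h x').2
      have l1 : (h x' : ℝ) ≠ 0 := fun e => hc₁ _ e (by rw [hconj]; exact hx1)
      have l2 : (x' : ℝ) ≠ 1 := fun e => hc₂ _ e hx2
      have m1 := lt_of_le_of_ne k2.1 l1.symm
      have m2 := lt_of_le_of_ne j2.2 l2
      change 0 < 1 + min (h x : ℝ) (h x') - max (x : ℝ) x'
      -- If minimum and maximum come from the same point, `hsep` applies; in the mixed cases `h x' >
      -- 0` or `x' < 1` gives strictness.
      rcases min_choice (h x : ℝ) (h x') with e | e <;>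
      rcases max_choice (x : ℝ) x' with e' | e' <;> rw [e, e'] <;>
      linarith [j1.1, j1.2, j2.1, k1.1, k1.2, k2.2])
  refine ⟨min γ₁ γ₂, lt_min hγ₁ hγ₂, fun t δ hδ => ?_⟩
  have hU : {x : Λ | |(t : ℝ) - x| < δ} ∈ 𝓝 t := by
    have : Continuous fun x : Λ => |(t : ℝ) - x| := by fun_prop
    exact (this.tendsto t).eventually_lt_const (by simpa using hδ)
  obtain ⟨R, hR⟩ := exists_block_of_mem_nhds (S := S) hU
  set m := R + 1 with hm
  -- `t'` copies the first `m` symbols of `t`, flips the next one, and then places `c₁` and `c₂`, so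
  -- that the pair enters `P` after `m` shifts.
  set t' : Λ := S.symm fun k => if k < m then S t k else if k = m then S t k + 1 else
    if k = m + 1 then c₁ else c₂ with ht'
  have hSt' : ∀ k, S t' k = if k < m then S t k else if k = m then S t k + 1 else
    if k = m + 1 then c₁ else c₂ := fun k => by rw [ht', S.apply_symm_apply]
  have hmem : (h^[m] t, h^[m] t') ∈ P := by
    refine ⟨?_, ?_, ?_⟩
    · simp only [symbol_iterate hconj, hSt']
      simp
    · simp only [symbol_iterate hconj, hSt']
      simp
    · simp only [symbol_iterate hconj, hSt']
      simp
  refine ⟨t', hR t' fun k hk => ?_, m, by omega, (min_le_left _ _).trans (hP₁ _ hmem), ?_⟩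
  · rw [hSt', if_pos (by omega)]
  · have := (min_le_right γ₁ γ₂).trans (hP₂ _ hmem)
    simpa only [Function.iterate_succ_apply'] using this

end Separation

/-! ### Solutions driven apart by an unmatched jump -/

section Sensitivity

variable {V : Type*} [NormedAddCommGroup V] [NormedSpace ℝ V]
  {F G : V → V} {θ θ' : ℤ → ℝ} {z z' : ℝ → V}

/-- If exactly one of two solutions with bounded velocities has a big jump at an isolated moment,
then the solutions are apart on an interval near this moment. -/
lemma exists_interval_apart (hθ : IsMomentSeq θ) (hθ' : IsMomentSeq θ')
    (hz : IsImpulsiveSolution F G θ univ z) (hz' : IsImpulsiveSolution F G θ' univ z')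
    {C η γ : ℝ} (hC : 0 < C) (hη : 0 < η) (hγ : 0 < γ)
    (hFz : ∀ t, ‖F (z t)‖ ≤ C) (hFz' : ∀ t, ‖F (z' t)‖ ≤ C) (hG : ∀ t, η ≤ ‖G (z' t)‖) {m : ℤ}
    (h₁ : θ m + γ ≤ θ' m) (h₂ : θ' m + γ ≤ θ (m + 1)) (h₃ : θ' m + γ ≤ θ' (m + 1)) :
    ∃ u v : ℝ, θ m ≤ u ∧ min (γ / 2) (η / (8 * C)) / 2 ≤ v - u ∧
      (∀ t ∈ Icc u v, η / 4 ≤ ‖z t - z' t‖) ∧ ∀ i, θ i ∉ Icc u v ∧ θ' i ∉ Icc u v := by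
  -- Within time `r` the difference changes by at most `2 * C * r ≤ η / 4`, and `r < γ` keeps the
  -- intervals free of other moments.
  set r := min (γ / 2) (η / (8 * C)) with hr
  have hr0 : 0 < r := lt_min (by positivity) (by positivity)
  have hrγ : r < γ := (min_le_left _ _).trans_lt (half_lt_self hγ)
  have hrη : 2 * C * r ≤ η / 4 := by
    calc 2 * C * r ≤ 2 * C * (η / (8 * C)) := by gcongr; exact min_le_right _ _
      _ = η / 4 := by field_simp; norm_num
  set B := θ' m with hB
  have hprev : θ' (m - 1) ≤ θ m := by
    have e1 := hθ'.moment_le (m - 1)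
    have e2 := hθ.le_moment m
    push_cast at e1
    linarith
  have hno : ∀ t, θ m < t → t < B + γ → t ∉ range θ := fun t e1 e2 =>
    hθ.notMem_range_of_mem_Ioo (i := m + 1) (by simpa using e1) (e2.trans_le h₂)
  have hno₁ : ∀ t, θ m < t → t < B → t ∉ range θ' := fun t e1 e2 =>
    hθ'.notMem_range_of_mem_Ioo (i := m) (hprev.trans_lt e1) e2
  have hno₂ : ∀ t, B < t → t < B + γ → t ∉ range θ' := fun t e1 e2 =>
    hθ'.notMem_range_of_mem_Ioo (i := m + 1) (by simpa using e1) (e2.trans_le h₃)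
  set w : ℝ → V := fun t => z t - z' t with hw
  have hwd : ∀ t, t ∉ range θ → t ∉ range θ' → HasDerivAt w (F (z t) - F (z' t)) t := fun t e1 e2 =>
    ((hz.ode t trivial e1).hasDerivAt univ_mem).sub ((hz'.ode t trivial e2).hasDerivAt univ_mem)
  have hle : ∀ t, ‖F (z t) - F (z' t)‖ ≤ 2 * C := fun t =>
    (norm_sub_le _ _).trans (by linarith [hFz t, hFz' t])
  have hv : ∀ t : ℝ, HasDerivAt (fun t => 2 * C * t) (2 * C) t := fun t => by
    simpa using (hasDerivAt_id t).const_mul (2 * C)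
  have hBθ : B ∉ range θ := hno B (by linarith) (by linarith)
  have hzB : ContinuousAt z B := ((hz.ode B trivial hBθ).hasDerivAt univ_mem).continuousAt
  have hwB : ContinuousWithinAt w (Iio B) B := by
    have e1 := (hz'.ode_left m trivial).continuousWithinAt
    rw [univ_inter] at e1
    exact hzB.continuousWithinAt.sub (e1.mono Iio_subset_Iic_self)
  have hwB' : Tendsto w (𝓝[>] B) (𝓝 (w B - G (z' B))) := by
    have e1 := (hzB.tendsto.mono_left nhdsWithin_le_nhds).sub (hz'.jump m trivial)
    rwa [← sub_sub] at e1
  -- Only `z'` jumps at `B`, by at least `η`, so the difference has norm at least `η / 2` at `B` or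
  -- in the right limit. The interval is placed on the corresponding side.
  by_cases hcase : η / 2 ≤ ‖w B‖
  · refine ⟨B - r, B - r / 2, by linarith, by linarith, fun t ht => ?_, fun i => ⟨fun hi => ?_,
      fun hi => ?_⟩⟩
    · have ht1 : θ m < t := by linarith [ht.1]
      have ht2 : t < B := by linarith [ht.2]
      have e1 := norm_sub_le_sub_of_norm_deriv_le ht2
        (fun s hs => hwd s (hno s (ht1.trans hs.1) (by linarith [hs.2]))
          (hno₁ s (ht1.trans hs.1) hs.2)) (fun s _ => hv s) hwB (hv B).continuousAt.continuousWithinAt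
        ((hwd t (hno t ht1 (by linarith)) (hno₁ t ht1 ht2)).continuousAt.tendsto.mono_left
          nhdsWithin_le_nhds) ((hv t).continuousAt.tendsto.mono_left nhdsWithin_le_nhds)
        (fun s _ => hle s)
      have e2 : 2 * C * B - 2 * C * t ≤ 2 * C * r := by
        rw [← mul_sub]; exact mul_le_mul_of_nonneg_left (by linarith [ht.1]) (by positivity)
      have e3 := norm_sub_norm_le (w B) (w t)
      change η / 4 ≤ ‖w t‖
      linarith
    · exact hno (θ i) (by linarith [hi.1]) (by linarith [hi.2]) ⟨i, rfl⟩
    · exact hno₁ (θ' i) (by linarith [hi.1]) (by linarith [hi.2]) ⟨i, rfl⟩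
  · have hbig : η / 2 ≤ ‖w B - G (z' B)‖ := by
      have e1 := norm_sub_norm_le (G (z' B)) (w B)
      rw [norm_sub_rev (G (z' B)) (w B)] at e1
      linarith [hG B]
    refine ⟨B + r / 2, B + r, by linarith, by linarith, fun t ht => ?_, fun i => ⟨fun hi => ?_,
      fun hi => ?_⟩⟩
    · have ht1 : B < t := by linarith [ht.1]
      have ht2 : t < B + γ := by linarith [ht.2]
      have hd : ∀ s, B < s → s ≤ t → HasDerivAt w (F (z s) - F (z' s)) s := fun s e1 e2 =>
        hwd s (hno s (by linarith) (by linarith)) (hno₂ s e1 (by linarith))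
      have e1 := norm_sub_le_sub_of_norm_deriv_le ht1 (fun s hs => hd s hs.1 hs.2.le)
        (fun s _ => hv s) (hd t ht1 le_rfl).continuousAt.continuousWithinAt
        (hv t).continuousAt.continuousWithinAt hwB'
        ((hv B).continuousAt.tendsto.mono_left nhdsWithin_le_nhds) (fun s _ => hle s)
      have e2 : 2 * C * t - 2 * C * B ≤ 2 * C * r := by
        rw [← mul_sub]; exact mul_le_mul_of_nonneg_left (by linarith [ht.2]) (by positivity)
      have e3 := norm_sub_norm_le (w B - G (z' B)) (w t)
      rw [norm_sub_rev (w t)] at e1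
      change η / 4 ≤ ‖w t‖
      linarith
    · exact hno (θ i) (by linarith [hi.1]) (by linarith [hi.2]) ⟨i, rfl⟩
    · exact hno₂ (θ' i) (by linarith [hi.1]) (by linarith [hi.2]) ⟨i, rfl⟩

end Sensitivity

/-! ### The four properties of the chaotic attractor -/

section Main

variable {n : ℕ} {A B : Matrix (Fin n) (Fin n) ℝ}
  {f W : EuclideanSpace ℝ (Fin n) → EuclideanSpace ℝ (Fin n)} {L N ω M : ℝ}
  {Λ : Set ℝ} {S : Λ ≃ₜ (ℕ → Fin 2)} {h : Λ → Λ}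

/-- A continuous algebra homomorphism commutes with exponentials and powers; as it is also isometric
here, decay of matrices becomes decay of operators. -/
lemma toEuclideanCLM_fundamentalMatrix (θ : ℤ → ℝ) (A B : Matrix (Fin n) (Fin n) ℝ) (t s : ℝ) :
    Matrix.toEuclideanCLM (𝕜 := ℝ) (fundamentalMatrix θ A B t s) =
      fundamentalMatrix θ (Matrix.toEuclideanCLM (𝕜 := ℝ) A) (Matrix.toEuclideanCLM (𝕜 := ℝ) B)
        t s := by
  have hc : Continuous (Matrix.toEuclideanCLM (n := Fin n) (𝕜 := ℝ)) :=
    (AddMonoidHomClass.isometry_of_norm (Matrix.toEuclideanCLM (n := Fin n) (𝕜 := ℝ))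
      fun X => Matrix.l2_opNorm_toEuclideanCLM X).continuous
  let _ : NormedAlgebra ℚ (Matrix (Fin n) (Fin n) ℝ) := NormedAlgebra.restrictScalars ℚ ℝ _
  let _ : NormedAlgebra ℚ (EuclideanSpace ℝ (Fin n) →L[ℝ] EuclideanSpace ℝ (Fin n)) :=
    NormedAlgebra.restrictScalars ℚ ℝ _
  rw [fundamentalMatrix, fundamentalMatrix, map_mul, map_pow, map_add, map_one,
    NormedSpace.map_exp _ hc, map_smul]

lemma isDecaying_of_transitionMatrix (hcomm : Commute A B) {θ : ℤ → ℝ} (hθ : IsMomentSeq θ)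
    (hZ : ∀ s, ∀ Φ, IsTransitionMatrix A B θ s Φ →
      ∀ t ≥ s, ‖Φ t‖ ≤ N * Real.exp (-ω * (t - s))) :
    IsDecaying (Matrix.toEuclideanCLM (𝕜 := ℝ) A) (Matrix.toEuclideanCLM (𝕜 := ℝ) B) N ω θ where
  toIsMomentSeq := hθ
  norm_le s t hst := by
    rw [← toEuclideanCLM_fundamentalMatrix, Matrix.l2_opNorm_toEuclideanCLM]
    exact hZ s (fun t => fundamentalMatrix θ A B t s)
      ⟨isImpulsiveSolution_fundamentalMatrix hθ hcomm s, fundamentalMatrix_self s⟩ t hst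

lemma isAttractor_of_contracting
    (H : IsContractingSystem (Matrix.toEuclideanCLM (𝕜 := ℝ) A) (Matrix.toEuclideanCLM (𝕜 := ℝ) B)
      f W L N ω M)
    (hdec : ∀ κ : ℤ → Λ, IsOrbit h κ → IsDecaying (Matrix.toEuclideanCLM (𝕜 := ℝ) A)
      (Matrix.toEuclideanCLM (𝕜 := ℝ) B) N ω (moments κ)) : IsAttractor A B f W h := by
  refine ⟨fun κ hκ => ?_, ⟨attractorRadius N ω M, fun κ hκ z hz t => ?_⟩, fun κ hκ z hz y hy => ?_⟩
  · obtain ⟨z, hz, K, hK⟩ := H.exists_bounded (hdec κ hκ)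
    refine ⟨z, ⟨hz, K, hK⟩, ?_⟩
    rintro y ⟨hy, K', hK'⟩
    exact H.bounded_unique (hdec κ hκ) hy hz hK' hK
  · obtain ⟨hz, K, hK⟩ := hz
    exact H.norm_le_radius (hdec κ hκ) hz hK t
  · obtain ⟨C, c, hC, hc, hrate⟩ := H.exists_rate
    set s := moments κ 0
    have h1 : Tendsto (fun t : ℝ => C * Real.exp (-c * (t - s)) * ‖y s - z s‖) atTop (𝓝 0) :=
      (IsContractingSystem.tendsto_mul_exp hc C _).comp (tendsto_atTop_add_const_right _ (-s) tendsto_id)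
    refine squeeze_zero' (Eventually.of_forall fun t => norm_nonneg _) ?_ h1
    filter_upwards [eventually_ge_atTop s] with t ht
    exact hrate (hdec κ hκ) hy (hz.1.mono (subset_univ _))
      (show Icc s t ⊆ Ici s from Icc_subset_Ici_self) ht

lemma isSensitive_of_contracting (hΛ : Λ ⊆ Icc 0 1) (S : Λ ≃ₜ (ℕ → Fin 2))
    (hconj : ∀ t, S (h t) = fun k => S t (k + 1)) (hsep : ∀ t : Λ, (t : ℝ) < 1 + (h t : ℝ))
    (H : IsContractingSystem (Matrix.toEuclideanCLM (𝕜 := ℝ) A) (Matrix.toEuclideanCLM (𝕜 := ℝ) B)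
      f W L N ω M)
    (hdec : ∀ κ : ℤ → Λ, IsOrbit h κ → IsDecaying (Matrix.toEuclideanCLM (𝕜 := ℝ) A)
      (Matrix.toEuclideanCLM (𝕜 := ℝ) B) N ω (moments κ))
    (hne : ∀ x, Matrix.toEuclideanCLM (𝕜 := ℝ) B x + W x ≠ 0) : IsSensitive A B f W h := by
  set R := attractorRadius N ω M
  set a := Matrix.toEuclideanCLM (𝕜 := ℝ) A
  set b := Matrix.toEuclideanCLM (𝕜 := ℝ) B
  have hR0 : 0 ≤ R := H.radius_nonneg
  obtain ⟨η, hη, hjump⟩ := (isCompact_closedBall (0 : EuclideanSpace ℝ (Fin n)) R).exists_forall_le'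
    (f := fun x => ‖b x + W x‖) (a := 0) (b.continuous.add H.W_continuous).norm.continuousOn
    (fun x _ => norm_pos_iff.2 (hne x))
  obtain ⟨γ, hγ, hpair⟩ := exists_separation hΛ S hconj hsep
  set C := ‖a‖ * R + M + 1 with hC
  have hC0 : 0 < C := by have := H.M_nonneg; positivity
  refine ⟨η / 4, by positivity, min (γ / 2) (η / (8 * C)) / 2, by positivity, fun t₀ δ hδ => ?_⟩
  obtain ⟨t₁, ht, m, hm, hg₁, hg₂⟩ := hpair t₀ δ hδ
  refine ⟨t₁, ht, ?_⟩
  rintro κ₀ κ₁ hκ₀ hκ₁ rfl rfl z₀ z₁ ⟨hz₀, K₀, hK₀⟩ ⟨hz₁, K₁, hK₁⟩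
  have hd₀ := hdec κ₀ hκ₀
  have hd₁ := hdec κ₁ hκ₁
  rw [← hκ₀.natCast, ← hκ₁.natCast] at hg₁ hg₂
  rw [← hκ₀.natCast, ← hκ₁.natCast] at hg₂
  have hb₀ := H.norm_le_radius hd₀ hz₀ hK₀
  have hb₁ := H.norm_le_radius hd₁ hz₁ hK₁
  have hF : ∀ z : ℝ → EuclideanSpace ℝ (Fin n), (∀ t, ‖z t‖ ≤ R) → ∀ t, ‖a (z t) + f (z t)‖ ≤ C := by
    intro z hz t
    have h1 := a.le_opNorm (z t)
    have h2 := mul_le_mul_of_nonneg_left (hz t) (norm_nonneg a)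
    have h3 := H.f_le (z t)
    exact (norm_add_le _ _).trans (by linarith)
  have hG : ∀ z : ℝ → EuclideanSpace ℝ (Fin n), (∀ t, ‖z t‖ ≤ R) → ∀ t, η ≤ ‖b (z t) + W (z t)‖ :=
    fun z hz t => hjump _ (mem_closedBall_zero_iff.2 (hz t))
  have hstart : ∀ κ : ℤ → Λ, IsMomentSeq (moments κ) → ∀ t : Λ, (t : ℝ) ≤ moments κ m := by
    intro κ hκ t
    have h1 := hκ.le_moment m
    have h2 := (hΛ t.2).2
    have h3 : (1 : ℝ) ≤ (m : ℝ) := by exact_mod_cast hm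
    push_cast at h1
    linarith
  have e₀ : moments κ₀ m = m + (κ₀ m : ℝ) := by simp [moments]
  have e₁ : moments κ₁ m = m + (κ₁ m : ℝ) := by simp [moments]
  have f₀ : moments κ₀ (m + 1) = m + 1 + (κ₀ ((m + 1 : ℕ) : ℤ) : ℝ) := by simp [moments]
  have f₁ : moments κ₁ (m + 1) = m + 1 + (κ₁ ((m + 1 : ℕ) : ℤ) : ℝ) := by simp [moments]
  have k₀ := min_le_left (κ₀ ((m + 1 : ℕ) : ℤ) : ℝ) (κ₁ ((m + 1 : ℕ) : ℤ))
  have k₁ := min_le_right (κ₀ ((m + 1 : ℕ) : ℤ) : ℝ) (κ₁ ((m + 1 : ℕ) : ℤ))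
  have l₀ := le_max_left (κ₀ (m : ℤ) : ℝ) (κ₁ (m : ℤ))
  have l₁ := le_max_right (κ₀ (m : ℤ) : ℝ) (κ₁ (m : ℤ))
  -- The solution whose `m`-th moment comes later plays the role of `z'`, the one with the unmatched
  -- jump.
  rcases le_total (κ₀ (m : ℤ) : ℝ) (κ₁ (m : ℤ)) with hle | hle
  · rw [abs_of_nonpos (by linarith)] at hg₁
    obtain ⟨u, v, h1, h2, h3, h4⟩ := exists_interval_apart hd₀.toIsMomentSeq hd₁.toIsMomentSeq
      hz₀ hz₁ hC0 hη hγ (hF z₀ hb₀) (hF z₁ hb₁) (hG z₁ hb₁) (m := m)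
      (by linarith) (by linarith) (by linarith)
    exact ⟨u, v, (hstart κ₀ hd₀.toIsMomentSeq _).trans h1, h2, h3, h4⟩
  · rw [abs_of_nonneg (by linarith)] at hg₁
    obtain ⟨u, v, h1, h2, h3, h4⟩ := exists_interval_apart hd₁.toIsMomentSeq hd₀.toIsMomentSeq
      hz₁ hz₀ hC0 hη hγ (hF z₁ hb₁) (hF z₀ hb₀) (hG z₀ hb₀) (m := m)
      (by linarith) (by linarith) (by linarith)
    exact ⟨u, v, (hstart κ₁ hd₁.toIsMomentSeq _).trans h1, h2,
      fun t ht => by rw [norm_sub_rev]; exact h3 t ht, fun i => (h4 i).symm⟩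

/-- Repeating the first `p` symbols of `κ₁ 0` gives an orbit of period `p` starting close to `κ₁ 0`.
The translate by `p` of its bounded solution has the same moments, so uniqueness makes the solution
periodic. -/
lemma periodicSolutionsDense_of_contracting (S : Λ ≃ₜ (ℕ → Fin 2))
    (hconj : ∀ t, S (h t) = fun k => S t (k + 1))
    (H : IsContractingSystem (Matrix.toEuclideanCLM (𝕜 := ℝ) A) (Matrix.toEuclideanCLM (𝕜 := ℝ) B)
      f W L N ω M)
    (hdec : ∀ κ : ℤ → Λ, IsOrbit h κ → IsDecaying (Matrix.toEuclideanCLM (𝕜 := ℝ) A)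
      (Matrix.toEuclideanCLM (𝕜 := ℝ) B) N ω (moments κ)) :
    PeriodicSolutionsDense A B f W h := by
  rintro κ₁ hκ₁ z₁ ⟨hz₁, K₁, hK₁⟩ ε hε E -
  obtain ⟨r, hr⟩ := H.exists_eventually_epsEquivalent (continuous_of_conj hconj) hdec hκ₁ hz₁ hK₁ hε
  obtain ⟨R, hR⟩ := exists_block_of_mem_nhds (S := S) hr
  set p : ℕ := R + 1 with hp
  set s : ℤ → Fin 2 := fun i => S (κ₁ 0) (i % p).toNat with hs
  have hκ := isOrbit_symbols hconj s
  set κ : ℤ → Λ := fun i => S.symm fun k => s (i + k) with hκdef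
  have hκp : (fun i => κ (i + p)) = κ := by
    funext i
    simp only [hκdef]
    congr 1
    funext k
    simp only [hs]
    rw [show i + (p : ℤ) + k = i + k + p by ring, Int.add_emod_right]
  obtain ⟨φ, hφ, K, hK⟩ := H.exists_bounded (hdec κ hκ)
  refine ⟨κ, φ, hκ, ⟨hφ, K, hK⟩, ⟨p, by omega, ?_⟩, r, ?_⟩
  · have h1 := hφ.translate p ((p : ℤ) : ℝ)
    rw [← moments_translate κ p, hκp] at h1
    have h2 := H.bounded_unique (hdec κ hκ) h1 hφ (fun t => hK _) hK
    intro t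
    simpa using congrFun h2 t
  · refine hR (κ 0) (fun k hk => ?_) κ hκ rfl φ K hφ hK
    simp only [hκdef, S.apply_symm_apply, hs, zero_add]
    rw [Int.emod_eq_of_lt (by omega) (by omega)]
    simp

/-- The forward orbit of the point with universal symbol sequence comes close to every `κ₁ 0`, and
translating by that time reduces to continuous dependence. Only forward symbols enter, so the past
of `κ` is free. -/
lemma exists_isDenseSolution_of_contracting (S : Λ ≃ₜ (ℕ → Fin 2))
    (hconj : ∀ t, S (h t) = fun k => S t (k + 1))
    (H : IsContractingSystem (Matrix.toEuclideanCLM (𝕜 := ℝ) A) (Matrix.toEuclideanCLM (𝕜 := ℝ) B)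
      f W L N ω M)
    (hdec : ∀ κ : ℤ → Λ, IsOrbit h κ → IsDecaying (Matrix.toEuclideanCLM (𝕜 := ℝ) A)
      (Matrix.toEuclideanCLM (𝕜 := ℝ) B) N ω (moments κ)) :
    ∃ t : Λ, ∀ κ : ℤ → Λ, IsOrbit h κ → κ 0 = t →
      ∀ z, IsBoundedSolution A B f W κ z → IsDenseSolution A B f W h κ z := by
  obtain ⟨s, hs⟩ := exists_universal_sequence
  refine ⟨S.symm s, ?_⟩
  rintro κ hκ hκ0 z ⟨hz, K, hK⟩ κ₁ hκ₁ z₁ ⟨hz₁, K₁, hK₁⟩ ε hε E -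
  obtain ⟨r, hr⟩ := H.exists_eventually_epsEquivalent (continuous_of_conj hconj) hdec hκ₁ hz₁ hK₁ hε
  obtain ⟨R, hR⟩ := exists_block_of_mem_nhds (S := S) hr
  obtain ⟨m, hm⟩ := hs (S (κ₁ 0)) R
  refine ⟨r, m, ?_⟩
  have h1 := hz.translate m ((m : ℤ) : ℝ)
  rw [← moments_translate κ m] at h1 ⊢
  refine hR (κ (0 + m)) (fun k hk => ?_) _ (hκ.translate m) rfl _ K h1 fun t => hK _
  rw [zero_add, hκ.natCast, hκ0, symbol_iterate hconj, S.apply_symm_apply, hm k hk]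

end Main

theorem mainTheorem2 {n : ℕ}
    -- the Cantor set `Λ ⊆ [0, 1]` and the map `h` conjugate to the shift on `Σ₂`
    (Λ : Set ℝ) (hΛ : Λ ⊆ Icc 0 1) (S : Λ ≃ₜ (ℕ → Fin 2)) (h : Λ → Λ)
    (hconj : ∀ t, S (h t) = fun k => S t (k + 1))
    -- consecutive impulse moments `ζ i < ζ (i + 1)` never coincide
    (hsep : ∀ t : Λ, (t : ℝ) < 1 + (h t : ℝ))
    (A B : Matrix (Fin n) (Fin n) ℝ)
    (f W : EuclideanSpace ℝ (Fin n) → EuclideanSpace ℝ (Fin n))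
    (L N ω q : ℝ)
    (hC1 : (1 + B).det ≠ 0)
    (hL : 0 < L)
    (hC2 : ∀ x₁ x₂, ‖f x₁ - f x₂‖ + ‖W x₁ - W x₂‖ ≤ L * ‖x₁ - x₂‖)
    (hC3 : ∀ x, Matrix.toEuclideanCLM (𝕜 := ℝ) B x + W x ≠ 0)
    (hC4 : BddAbove (range fun x => ‖f x‖) ∧ BddAbove (range fun x => ‖W x‖))
    (hC5 : SpectralCondition A B)
    -- `N` and `ω` are the constants of the exponential decay of the transition matrices
    (hN : 0 < N) (hω : 0 < ω)
    (hZ : ∀ κ : ℤ → Λ, IsOrbit h κ → ∀ s, ∀ Φ, IsTransitionMatrix A B (moments κ) s Φ →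
      ∀ t ≥ s, ‖Φ t‖ ≤ N * Real.exp (-ω * (t - s)))
    (hC6 : N * L * (2 / ω + Real.exp ω / (1 - Real.exp (-ω))) < 1)
    (hC7 : -ω + N * L + Real.log (1 + N * L) < 0)
    (hq : 3 ≤ q) (hq' : 1 / q < 2 * expMin A / (3 * expMax A))
    (hC8 : L < (2 * expMin A / (3 * expMax A) - 1 / q) * expMin A *
        jumpMin B W (solBound f W N ω) /
      (2 * solBound f W N ω * (expMax A + expMin A))) :
    IsChaoticAttractor A B f W h := by
  obtain ⟨⟨Mf, hMf⟩, MW, hMW⟩ := hC4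
  have H : IsContractingSystem (Matrix.toEuclideanCLM (𝕜 := ℝ) A)
      (Matrix.toEuclideanCLM (𝕜 := ℝ) B) f W L N ω (max Mf MW) :=
    { comm := hC5.1.map (Matrix.toEuclideanCLM (n := Fin n) (𝕜 := ℝ))
      N_pos := hN
      ω_pos := hω
      L_nonneg := hL.le
      f_lip := fun x y => by linarith [hC2 x y, norm_nonneg (W x - W y)]
      W_lip := fun x y => by linarith [hC2 x y, norm_nonneg (f x - f y)]
      f_le := fun x => (hMf (mem_range_self x)).trans (le_max_left _ _)
      W_le := fun x => (hMW (mem_range_self x)).trans (le_max_right _ _)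
      rate := hC7 }
  have hdec : ∀ κ : ℤ → Λ, IsOrbit h κ → IsDecaying (Matrix.toEuclideanCLM (𝕜 := ℝ) A)
      (Matrix.toEuclideanCLM (𝕜 := ℝ) B) N ω (moments κ) := fun κ hκ =>
    isDecaying_of_transitionMatrix hC5.1 (isMomentSeq_moments hΛ hsep hκ) (hZ κ hκ)
  exact ⟨isAttractor_of_contracting H hdec,
    isSensitive_of_contracting hΛ S hconj hsep H hdec hC3,
    periodicSolutionsDense_of_contracting S hconj H hdec,
    exists_isDenseSolution_of_contracting S hconj H hdec⟩
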